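/- **Conventions.** Let $k$ be a field; algebras are associative unital $k$-algebras and $\otimes=\otimes_k$. For a linear map $R:B\otimes A\to A\otimes B$ write $R(b\otimes a)=a_R\otimes b_R$, for $Q:A\otimes B\to A\otimes B$ write $Q(a\otimes b)=a_Q\otimes b_Q$ (summation understood; $r$, $q$ denote further copies of $R$, $Q$). If $A,B$ are algebras, we say that $A\,{}_Q\otimes_R B$ is an *L-R-twisted tensor product of algebras* if for all $a,a'\in A$, $b,b'\in B$: $$a_R\otimes 1_R=a\otimes 1,\quad 1_R\otimes b_R=1\otimes b,\quad (aa')_R\otimes b_R=a_Ra'_r\otimes b_{R_r},\quad a_R\otimes (bb')_R=a_{R_r}\otimes b_rb'_R,$$ $$a_Q\otimes 1_Q=a\otimes 1,\quad 1_Q\otimes b_Q=1\otimes b,\quad (aa')_Q\otimes b_Q=a_qa'_Q\otimes b_{Q_q},\quad a_Q\otimes (bb')_Q=a_{Q_q}\otimes b_Qb'_q,$$ $$(\ast)\quad b_R\otimes a_{R_Q}\otimes b'_Q=b_R\otimes a_{Q_R}\otimes b'_Q,\qquad a_R\otimes b_{R_Q}\otimes a'_Q=a_R\otimes b_{Q_R}\otimes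 a'_Q .$$ Then $A\otimes B$ with $(a\otimes b)(a'\otimes b')=a_Qa'_R\otimes b_Rb'_Q$ is an algebra with unit $1\otimes 1$, denoted $A\,{}_Q\otimes_RB$. **Theorem (invariance under twisting).** Let $A,B$ be algebras, $R:B\otimes A\to A\otimes B$ and $Q:A\otimes B\to A\otimes B$ linear maps such that $A\,{}_Q\otimes_RB$ is an L-R-twisted tensor product of algebras (in particular $(\ast)$ holds). Let $\mu_l:B\otimes A\to A$, $b\otimes a\mapsto b\cdot a$; $\mu_r:A\otimes B\to A$, $a\otimes b\mapsto a\cdot b$; $\rho_r:A\to A\otimes B$, $\rho_r(a)=a_{(0)}\otimes a_{(1)}$; $\rho_l:A\to B\otimes A$, $\rho_l(a)=a_{<-1>}\otimes a_{<0>}$ be linear maps, and put $a\bullet a'=(a_{(0)}\cdot a'_{<-1>})(a_{(1)}\cdot a'_{<0>})$. Assume $\rho_r(1)=1\otimes1$, $\rho_l(1)=1\otimes 1$, $1\cdot a=a=a\cdot 1$, $a_{(0)}(a_{(1)}\cdot 1)=a$, $(1\cdot a_{<-1>})a_{<0>}=a$, and for all $a,a'\in A$, $b\in B$: 1. $b\cdot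 (a_{(0)}(a_{(1)}\cdot a'))=a_{(0)_R}(b_Ra_{(1)}\cdot a')$, 2. $((a\cdot a'_{<-1>})a'_{<0>})\cdot b=(a\cdot a'_{<-1>}b_Q)a'_{<0>_Q}$, 3. $\rho_r(a\bullet a')=(a_{(0)}\cdot a'_{(0)_{R_{<-1>}}})a'_{(0)_{R_{<0>}}}\otimes a_{(1)_R}a'_{(1)}$, 4. $\rho_l(a\bullet a')=a_{<-1>}a'_{<-1>_Q}\otimes a_{<0>_{Q_{(0)}}}(a_{<0>_{Q_{(1)}}}\cdot a'_{<0>})$, 5. $a_{(0)_{<-1>}}\otimes a_{(0)_{<0>}}\otimes a_{(1)}=a_{<-1>}\otimes a_{<0>_{(0)}}\otimes a_{<0>_{(1)}}$, 6. $a_{Q_{(0)}}\otimes a_{Q_{(1)}}\otimes b_Q=a_{(0)_Q}\otimes a_{(1)}\otimes b_Q$, 7. $a_{R_{<-1>}}\otimes a_{R_{<0>}}\otimes b_R=a_{<-1>}\otimes a_{<0>_R}\otimes b_R$. Let moreover $\lambda_r:A\to A\otimes B$, $\lambda_r(a)=a_{[0]}\otimes a_{[1]}$, and $\lambda_l:A\to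 B\otimes A$, $\lambda_l(a)=a_{\{-1\}}\otimes a_{\{0\}}$, be linear maps with $\lambda_r(1)=1\otimes1$, $\lambda_l(1)=1\otimes 1$ and, for all $a,a'\in A$, $b,b'\in B$: 8. $a_{(0)_{[0]}}\otimes a_{(0)_{[1]}}a_{(1)}=a\otimes 1$, 9. $a_{[0]_{(0)}}\otimes a_{[0]_{(1)}}a_{[1]}=a\otimes 1$, 10. $a_{<-1>}a_{<0>_{\{-1\}}}\otimes a_{<0>_{\{0\}}}=1\otimes a$, 11. $a_{\{-1\}}a_{\{0\}_{<-1>}}\otimes a_{\{0\}_{<0>}}=1\otimes a$, 12. $a_{[0]_{\{-1\}}}\otimes a_{[0]_{\{0\}}}\otimes a_{[1]}=a_{\{-1\}}\otimes a_{\{0\}_{[0]}}\otimes a_{\{0\}_{[1]}}$, 13. $a_{[0]_{<-1>}}\otimes a_{[0]_{<0>}}\otimes a_{[1]}=a_{<-1>}\otimes a_{<0>_{[0]}}\otimes a_{<0>_{[1]}}$, 14. $a_{(0)_{\{-1\}}}\otimes a_{(0)_{\{0\}}}\otimes a_{(1)}=a_{\{-1\}}\otimes a_{\{0\}_{(0)}}\otimes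 a_{\{0\}_{(1)}}$, 15. $\lambda_r(aa')=a_{[0]_{(0)}}(a_{[0]_{(1)}}\cdot a'_{R_{[0]}})\otimes a'_{R_{[1]}}a_{[1]_R}$, 16. $\lambda_l(aa')=a'_{\{-1\}_Q}a_{Q_{\{-1\}}}\otimes (a_{Q_{\{0\}}}\cdot a'_{\{0\}_{<-1>}})a'_{\{0\}_{<0>}}$, 17. $\rho_l((a\cdot a'_{<-1>})a'_{<0>})=a_{<-1>}a'_{<-1>_Q}\otimes a_{<0>_Q}a'_{<0>}$, 18. $a_{(0)_{<-1>_R}}a'_{(1)_Q}\otimes a_{(0)_{<0>_Q}}\otimes a'_{(0)_{<0>_R}}\otimes a'_{(0)_{<-1>}}\otimes a_{(1)}=a'_{(1)}a_{(0)_{<-1>}}\otimes a_{(0)_{<0>}}\otimes a'_{(0)_{<0>}}\otimes a'_{(0)_{<-1>}}\otimes a_{(1)}$, 19. $a'_{<0>_{Q_{\{-1\}_R}}}a_{(1)}\otimes a'_{<0>_{Q_{\{0\}}}}\otimes a'_{<-1>}\otimes a_{(0)_R}\otimes b_Q=a_{(1)_q}a'_{<0>_{Q_{q_{\{-1\}}}}}\otimes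 a'_{<0>_{Q_{q_{\{0\}}}}}\otimes a'_{<-1>}\otimes a_{(0)}\otimes b_Q$, 20. $a_{(0)_{R_{[0]}}}\otimes a'_{<-1>}a_{(0)_{R_{[1]_Q}}}\otimes a'_{<0>_Q}\otimes a_{(1)}\otimes b_R=a_{(0)_{r_{R_{[0]}}}}\otimes a_{(0)_{r_{R_{[1]}}}}a'_{<-1>_R}\otimes a'_{<0>}\otimes a_{(1)}\otimes b_r$, 21. $a_{<0>_{Q_{\{0\}_{(0)_R}}}}\otimes a_{<0>_{Q_{\{0\}_{(1)}}}}\otimes a_{<-1>}\otimes a_{<0>_{Q_{\{-1\}}}}\otimes b_R\otimes b'_Q=a_{(0)_{R_{<0>_{Q_{\{0\}}}}}}\otimes a_{(1)}\otimes a_{(0)_{R_{<-1>}}}\otimes a_{(0)_{R_{<0>_{Q_{\{-1\}}}}}}\otimes b_R\otimes b'_Q$, 22. $a_{(0)_{R_{[1]}}}\otimes a_{(0)_{R_{[0]_{<0>_Q}}}}\otimes a_{(0)_{R_{[0]_{<-1>}}}}\otimes a_{(1)}\otimes b_R\otimes b'_Q=a_{(0)_{<0>_{R_{Q_{[1]}}}}}\otimes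 a_{(0)_{<0>_{R_{Q_{[0]}}}}}\otimes a_{(0)_{<-1>}}\otimes a_{(1)}\otimes b_R\otimes b'_Q$, 23. $(a_{(0)}\cdot b')_{R_{[0]_{(0)}}}\otimes (a_{(0)}\cdot b')_{R_{[0]_{(1)}}}\otimes (a_{(0)}\cdot b')_{R_{[1]}}\otimes b_R\otimes a_{(1)}=a_{(0)_{R_{[0]_{(0)}}}}\cdot b'\otimes a_{(0)_{R_{[0]_{(1)}}}}\otimes a_{(0)_{R_{[1]}}}\otimes b_R\otimes a_{(1)}$, 24. $a'_{<-1>}\otimes (b\cdot a'_{<0>})_{Q_{\{-1\}}}\otimes (b\cdot a'_{<0>})_{Q_{\{0\}_{<-1>}}}\otimes (b\cdot a'_{<0>})_{Q_{\{0\}_{<0>}}}\otimes b'_Q=a'_{<-1>}\otimes a'_{<0>_{Q_{\{-1\}}}}\otimes a'_{<0>_{Q_{\{0\}_{<-1>}}}}\otimes b\cdot a'_{<0>_{Q_{\{0\}_{<0>}}}}\otimes b'_Q$. Define $\tilde R:B\otimes A\to A\otimes B$ and $\tilde Q:A\otimes B\to A\otimes B$ by $$\tilde R(b\otimes a)=a_{(0)_{R_{[0]}}}\otimes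 a_{(0)_{R_{[1]}}}b_Ra_{(1)},\qquad \tilde Q(a\otimes b)=a_{<0>_{Q_{\{0\}}}}\otimes a_{<-1>}b_Qa_{<0>_{Q_{\{-1\}}}} .$$ Then $\tilde A=(A,\bullet,1)$ is an associative unital algebra, $\tilde A\,{}_{\tilde Q}\otimes_{\tilde R}B$ is an L-R-twisted tensor product of algebras (in particular an associative algebra with unit $1\otimes1$, as is $A\,{}_Q\otimes_RB$), and $$\tilde A\,{}_{\tilde Q}\otimes_{\tilde R}B\to A\,{}_Q\otimes_RB,\qquad a\otimes b\mapsto a_{(0)_{<0>}}\otimes a_{(1)}\,b\,a_{(0)_{<-1>}},$$ is a (bijective, unital) algebra isomorphism. -/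

import Mathlib

open scoped TensorProduct

namespace LRTwist

noncomputable section

/-! ### Sweedler sums -/

section Sweedler

variable {k M N P V : Type*} [Field k]
  [AddCommMonoid M] [Module k M] [AddCommMonoid N] [Module k N]
  [AddCommMonoid P] [Module k P] [AddCommMonoid V] [Module k V]

/-- Sweedler notation: choose a finite expression `t = ∑ i, x i ⊗ y i` and form `∑ i, f (x i) (y i)`.
Whenever `f` is bilinear (which is the case everywhere below) this does not depend on the chosen
expression and equals `TensorProduct.lift f t`, see `sw_eq_lift`. So
`sw (ρ a) fun x y => … x … y …` stands for `… a₍₀₎ … a₍₁₎ …`, where `ρ a = a₍₀₎ ⊗ a₍₁₎`. -/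
def sw (t : M ⊗[k] N) (f : M → N → P) : P :=
  ∑ i ∈ Classical.choose (TensorProduct.exists_finset t), f i.1 i.2

theorem sw_eq_lift (F : M →ₗ[k] N →ₗ[k] P) (t : M ⊗[k] N) :
    sw t (fun x y => F x y) = TensorProduct.lift F t := by
  conv_rhs => rw [Classical.choose_spec (TensorProduct.exists_finset t)]
  simp [sw]

theorem sw_eq_lift_mk (f : M → N → P) (h₁ : ∀ y, IsLinearMap k fun x => f x y)
    (h₂ : ∀ x, IsLinearMap k (f x)) (t : M ⊗[k] N) :
    sw t f = TensorProduct.lift (LinearMap.mk₂ k f (fun x x' y => (h₁ y).map_add x x')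
      (fun c x y => (h₁ y).map_smul c x) (fun x => (h₂ x).map_add)
      (fun c x => (h₂ x).map_smul c)) t :=
  sw_eq_lift (LinearMap.mk₂ k f _ _ _ _) t

theorem sw_tmul (f : M → N → P) (h₁ : ∀ y, IsLinearMap k fun x => f x y)
    (h₂ : ∀ x, IsLinearMap k (f x)) (x : M) (y : N) : sw (x ⊗ₜ[k] y) f = f x y := by
  rw [sw_eq_lift_mk f h₁ h₂]; simp

theorem lin_sw {t : V → M ⊗[k] N} {f : M → N → P} (ht : IsLinearMap k t)
    (h₁ : ∀ y, IsLinearMap k fun x => f x y) (h₂ : ∀ x, IsLinearMap k fun y => f x y) :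
    IsLinearMap k fun v => sw (t v) f := by
  constructor
  · intro v w; simp only [sw_eq_lift_mk f h₁ h₂, ht.map_add, map_add]
  · intro c v; simp only [sw_eq_lift_mk f h₁ h₂, ht.map_smul, map_smul]

theorem lin_sw' {t : M ⊗[k] N} {f : V → M → N → P}
    (h : ∀ x y, IsLinearMap k fun v => f v x y) : IsLinearMap k fun v => sw t (f v) := by
  constructor
  · intro v w; simp only [sw, (h _ _).map_add, Finset.sum_add_distrib]
  · intro c v; simp only [sw, (h _ _).map_smul, Finset.smul_sum]

theorem lin_id : IsLinearMap k fun v : V => v := ⟨fun _ _ => rfl, fun _ _ => rfl⟩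

theorem lin_app (g : M →ₗ[k] N) {f : V → M} (hf : IsLinearMap k f) :
    IsLinearMap k fun v => g (f v) :=
  ⟨fun v w => by simp [hf.map_add], fun c v => by simp [hf.map_smul]⟩

theorem lin_app₂ (g : M →ₗ[k] N →ₗ[k] P) {f : V → M} (hf : IsLinearMap k f) (y : N) :
    IsLinearMap k fun v => g (f v) y :=
  ⟨fun v w => by simp [hf.map_add], fun c v => by simp [hf.map_smul]⟩

theorem lin_tmul {f : V → M} (hf : IsLinearMap k f) (y : N) :
    IsLinearMap k fun v => f v ⊗ₜ[k] y :=
  lin_app₂ (TensorProduct.mk k M N) hf y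

theorem lin_tmul' (x : M) {f : V → N} (hf : IsLinearMap k f) :
    IsLinearMap k fun v => x ⊗ₜ[k] f v :=
  lin_app (TensorProduct.mk k M N x) hf

theorem lin_mul {A : Type*} [Ring A] [Algebra k A] {f : V → A} (hf : IsLinearMap k f) (y : A) :
    IsLinearMap k fun v => f v * y :=
  lin_app₂ (LinearMap.mul k A) hf y

theorem lin_mul' {A : Type*} [Ring A] [Algebra k A] (x : A) {f : V → A} (hf : IsLinearMap k f) :
    IsLinearMap k fun v => x * f v :=
  lin_app (LinearMap.mul k A x) hf

/-- A function of two variables that is linear in each of them, as a bundled bilinear map. -/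
def bilin (f : M → N → P) (h₁ : ∀ y, IsLinearMap k fun x => f x y)
    (h₂ : ∀ x, IsLinearMap k fun y => f x y) : M →ₗ[k] N →ₗ[k] P :=
  LinearMap.mk₂ k f (fun x x' y => (h₁ y).map_add x x') (fun c x y => (h₁ y).map_smul c x)
    (fun x => (h₂ x).map_add) (fun c x => (h₂ x).map_smul c)

end Sweedler

/-! ### Algebra structures and L-R-twisted tensor products -/

section LR

variable {k A B V : Type*} [Field k] [AddCommMonoid A] [Module k A] [AddCommMonoid B] [Module k B]
  [AddCommMonoid V] [Module k V]

/-- The bilinear multiplication `m` and the element `e` make the vector space `V` an associative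
unital algebra. -/
structure IsAlgebraStructure (m : V →ₗ[k] V →ₗ[k] V) (e : V) : Prop where
  mul_assoc : ∀ x y z, m (m x y) z = m x (m y z)
  one_mul : ∀ x, m e x = x
  mul_one : ∀ x, m x e = x

/-- `(a ⊗ b)(a' ⊗ b') = a_Q a'_R ⊗ b_R b'_Q` on `A ⊗ B`, where `R (b ⊗ a') = a'_R ⊗ b_R`,
`Q (a ⊗ b') = a_Q ⊗ b'_Q`, and `A`, `B` have the multiplications `mA`, `mB`. -/
def lrMul (mA : A →ₗ[k] A →ₗ[k] A) (mB : B →ₗ[k] B →ₗ[k] B)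
    (R : B ⊗[k] A →ₗ[k] A ⊗[k] B) (Q : A ⊗[k] B →ₗ[k] A ⊗[k] B) :
    A ⊗[k] B →ₗ[k] A ⊗[k] B →ₗ[k] A ⊗[k] B :=
  bilin
    (fun x y =>
      sw x fun a b => sw y fun a' b' => sw (Q (a ⊗ₜ b')) fun aQ b'Q =>
        sw (R (b ⊗ₜ a')) fun a'R bR => mA aQ a'R ⊗ₜ mB bR b'Q)
    (by
      repeat' first
        | intro _ | exact lin_id | apply lin_sw | apply lin_sw' | apply lin_tmul | apply lin_tmul'
        | apply lin_app | apply lin_app₂)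
    (by
      repeat' first
        | intro _ | exact lin_id | apply lin_sw | apply lin_sw' | apply lin_tmul | apply lin_tmul'
        | apply lin_app | apply lin_app₂)

/-- The conditions on `R : B ⊗ A → A ⊗ B` and `Q : A ⊗ B → A ⊗ B` under which there is an
L-R-twisted tensor product of the algebras `(A, mA, eA)` and `(B, mB, eB)`. -/
structure IsLRTwisting (mA : A →ₗ[k] A →ₗ[k] A) (eA : A) (mB : B →ₗ[k] B →ₗ[k] B) (eB : B)
    (R : B ⊗[k] A →ₗ[k] A ⊗[k] B) (Q : A ⊗[k] B →ₗ[k] A ⊗[k] B) : Prop where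
  R_one_left : ∀ a, R (eB ⊗ₜ a) = a ⊗ₜ eB
  R_one_right : ∀ b, R (b ⊗ₜ eA) = eA ⊗ₜ b
  /-- `(aa')_R ⊗ b_R = a_R a'_r ⊗ b_{R_r}` -/
  R_mul_left : ∀ a a' b,
    R (b ⊗ₜ mA a a') =
      sw (R (b ⊗ₜ a)) fun aR bR => sw (R (bR ⊗ₜ a')) fun a'r bRr => mA aR a'r ⊗ₜ bRr
  /-- `a_R ⊗ (bb')_R = a_{R_r} ⊗ b_r b'_R` -/
  R_mul_right : ∀ a b b',
    R (mB b b' ⊗ₜ a) =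
      sw (R (b' ⊗ₜ a)) fun aR b'R => sw (R (b ⊗ₜ aR)) fun aRr br => aRr ⊗ₜ mB br b'R
  Q_one_right : ∀ a, Q (a ⊗ₜ eB) = a ⊗ₜ eB
  Q_one_left : ∀ b, Q (eA ⊗ₜ b) = eA ⊗ₜ b
  /-- `(aa')_Q ⊗ b_Q = a_q a'_Q ⊗ b_{Q_q}` -/
  Q_mul_left : ∀ a a' b,
    Q (mA a a' ⊗ₜ b) =
      sw (Q (a' ⊗ₜ b)) fun a'Q bQ => sw (Q (a ⊗ₜ bQ)) fun aq bQq => mA aq a'Q ⊗ₜ bQq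
  /-- `a_Q ⊗ (bb')_Q = a_{Q_q} ⊗ b_Q b'_q` -/
  Q_mul_right : ∀ a b b',
    Q (a ⊗ₜ mB b b') =
      sw (Q (a ⊗ₜ b)) fun aQ bQ => sw (Q (aQ ⊗ₜ b')) fun aQq b'q => aQq ⊗ₜ mB bQ b'q
  /-- `b_R ⊗ a_{R_Q} ⊗ b'_Q = b_R ⊗ a_{Q_R} ⊗ b'_Q` -/
  comm_A : ∀ a b b',
    (sw (R (b ⊗ₜ a)) fun aR bR => sw (Q (aR ⊗ₜ b')) fun aRQ b'Q =>
      bR ⊗ₜ[k] aRQ ⊗ₜ[k] b'Q) =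
    sw (Q (a ⊗ₜ b')) fun aQ b'Q => sw (R (b ⊗ₜ aQ)) fun aQR bR => bR ⊗ₜ[k] aQR ⊗ₜ[k] b'Q
  /-- `a_R ⊗ b_{R_Q} ⊗ a'_Q = a_R ⊗ b_{Q_R} ⊗ a'_Q` -/
  comm_B : ∀ a a' b,
    (sw (R (b ⊗ₜ a)) fun aR bR => sw (Q (a' ⊗ₜ bR)) fun a'Q bRQ =>
      aR ⊗ₜ[k] bRQ ⊗ₜ[k] a'Q) =
    sw (Q (a' ⊗ₜ b)) fun a'Q bQ => sw (R (bQ ⊗ₜ a)) fun aR bQR => aR ⊗ₜ[k] bQR ⊗ₜ[k] a'Q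

end LR

/-! ### The deformed multiplication and the maps `R̃`, `Q̃` -/

section Twist

variable {k A B : Type*} [Field k] [Ring A] [Algebra k A] [Ring B] [Algebra k B]

/-- `a • a' = (a₍₀₎ · a'_{<-1>}) (a₍₁₎ · a'_{<0>})`. -/
def bullet (μl : B ⊗[k] A →ₗ[k] A) (μr : A ⊗[k] B →ₗ[k] A)
    (ρr : A →ₗ[k] A ⊗[k] B) (ρl : A →ₗ[k] B ⊗[k] A) : A →ₗ[k] A →ₗ[k] A :=
  bilin
    (fun a a' =>
      sw (ρr a) fun a0 a1 => sw (ρl a') fun m' z' => μr (a0 ⊗ₜ m') * μl (a1 ⊗ₜ z'))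
    (by
      repeat' first
        | intro _ | exact lin_id | apply lin_sw | apply lin_sw' | apply lin_tmul | apply lin_tmul'
        | apply lin_mul | apply lin_mul' | apply lin_app)
    (by
      repeat' first
        | intro _ | exact lin_id | apply lin_sw | apply lin_sw' | apply lin_tmul | apply lin_tmul'
        | apply lin_mul | apply lin_mul' | apply lin_app)

/-- `R̃ (b ⊗ a) = a_{(0)_{R_{[0]}}} ⊗ a_{(0)_{R_{[1]}}} b_R a_{(1)}`. -/
def tildeR (R : B ⊗[k] A →ₗ[k] A ⊗[k] B) (ρr lamr : A →ₗ[k] A ⊗[k] B) :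
    B ⊗[k] A →ₗ[k] A ⊗[k] B :=
  TensorProduct.lift <| bilin
    (fun b a =>
      sw (ρr a) fun a0 a1 => sw (R (b ⊗ₜ a0)) fun aR bR => sw (lamr aR) fun l0 l1 =>
        l0 ⊗ₜ (l1 * bR * a1))
    (by
      repeat' first
        | intro _ | exact lin_id | apply lin_sw | apply lin_sw' | apply lin_tmul | apply lin_tmul'
        | apply lin_mul | apply lin_mul' | apply lin_app)
    (by
      repeat' first
        | intro _ | exact lin_id | apply lin_sw | apply lin_sw' | apply lin_tmul | apply lin_tmul'
        | apply lin_mul | apply lin_mul' | apply lin_app)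

/-- `Q̃ (a ⊗ b) = a_{<0>_{Q_{{0}}}} ⊗ a_{<-1>} b_Q a_{<0>_{Q_{{-1}}}}`. -/
def tildeQ (Q : A ⊗[k] B →ₗ[k] A ⊗[k] B) (ρl laml : A →ₗ[k] B ⊗[k] A) :
    A ⊗[k] B →ₗ[k] A ⊗[k] B :=
  TensorProduct.lift <| bilin
    (fun a b =>
      sw (ρl a) fun m z => sw (Q (z ⊗ₜ b)) fun zQ bQ => sw (laml zQ) fun n w =>
        w ⊗ₜ (m * bQ * n))
    (by
      repeat' first
        | intro _ | exact lin_id | apply lin_sw | apply lin_sw' | apply lin_tmul | apply lin_tmul'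
        | apply lin_mul | apply lin_mul' | apply lin_app)
    (by
      repeat' first
        | intro _ | exact lin_id | apply lin_sw | apply lin_sw' | apply lin_tmul | apply lin_tmul'
        | apply lin_mul | apply lin_mul' | apply lin_app)

/-- The axioms on `R, Q, μl, μr, ρr, ρl` that make `•` an associative product with unit `1`. Here
`ρr a = a₍₀₎ ⊗ a₍₁₎`, `ρl a = a_{<-1>} ⊗ a_{<0>}`, `μl (b ⊗ a) = b · a`, `μr (a ⊗ b) = a · b`. -/
structure BulletAxioms (R : B ⊗[k] A →ₗ[k] A ⊗[k] B) (Q : A ⊗[k] B →ₗ[k] A ⊗[k] B)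
    (μl : B ⊗[k] A →ₗ[k] A) (μr : A ⊗[k] B →ₗ[k] A)
    (ρr : A →ₗ[k] A ⊗[k] B) (ρl : A →ₗ[k] B ⊗[k] A) : Prop where
  /-- `b_R ⊗ a_{R_Q} ⊗ b'_Q = b_R ⊗ a_{Q_R} ⊗ b'_Q` -/
  comm_A : ∀ a b b',
    (sw (R (b ⊗ₜ a)) fun aR bR => sw (Q (aR ⊗ₜ b')) fun aRQ b'Q =>
      bR ⊗ₜ[k] aRQ ⊗ₜ[k] b'Q) =
    sw (Q (a ⊗ₜ b')) fun aQ b'Q => sw (R (b ⊗ₜ aQ)) fun aQR bR => bR ⊗ₜ[k] aQR ⊗ₜ[k] b'Q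
  ρr_one : ρr 1 = 1 ⊗ₜ 1
  ρl_one : ρl 1 = 1 ⊗ₜ 1
  one_act : ∀ a, μl (1 ⊗ₜ a) = a
  act_one : ∀ a, μr (a ⊗ₜ 1) = a
  /-- `a₍₀₎ (a₍₁₎ · 1) = a` -/
  ρr_act_one : ∀ a, (sw (ρr a) fun a0 a1 => a0 * μl (a1 ⊗ₜ 1)) = a
  /-- `(1 · a_{<-1>}) a_{<0>} = a` -/
  ρl_one_act : ∀ a, (sw (ρl a) fun m z => μr (1 ⊗ₜ m) * z) = a
  /-- `b · (a₍₀₎ (a₍₁₎ · a')) = a_{(0)_R} (b_R a₍₁₎ · a')` -/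
  act_left : ∀ a a' b,
    μl (b ⊗ₜ sw (ρr a) fun a0 a1 => a0 * μl (a1 ⊗ₜ a')) =
      sw (ρr a) fun a0 a1 => sw (R (b ⊗ₜ a0)) fun aR bR => aR * μl ((bR * a1) ⊗ₜ a')
  /-- `((a · a'_{<-1>}) a'_{<0>}) · b = (a · a'_{<-1>} b_Q) a'_{<0>_Q}` -/
  act_right : ∀ a a' b,
    μr ((sw (ρl a') fun m' z' => μr (a ⊗ₜ m') * z') ⊗ₜ b) =
      sw (ρl a') fun m' z' => sw (Q (z' ⊗ₜ b)) fun z'Q bQ => μr (a ⊗ₜ (m' * bQ)) * z'Q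
  /-- `ρr (a • a') = (a₍₀₎ · a'_{(0)_{R_{<-1>}}}) a'_{(0)_{R_{<0>}}} ⊗ a_{(1)_R} a'_{(1)}` -/
  ρr_bullet : ∀ a a',
    ρr (bullet μl μr ρr ρl a a') =
      sw (ρr a) fun a0 a1 => sw (ρr a') fun a'0 a'1 => sw (R (a1 ⊗ₜ a'0)) fun a'R a1R =>
        sw (ρl a'R) fun m z => (μr (a0 ⊗ₜ m) * z) ⊗ₜ (a1R * a'1)
  /-- `ρl (a • a') = a_{<-1>} a'_{<-1>_Q} ⊗ a_{<0>_{Q_{(0)}}} (a_{<0>_{Q_{(1)}}} · a'_{<0>})` -/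
  ρl_bullet : ∀ a a',
    ρl (bullet μl μr ρr ρl a a') =
      sw (ρl a) fun m z => sw (ρl a') fun m' z' => sw (Q (z ⊗ₜ m')) fun zQ m'Q =>
        sw (ρr zQ) fun z0 z1 => (m * m'Q) ⊗ₜ (z0 * μl (z1 ⊗ₜ z'))
  /-- `a_{(0)_{<-1>}} ⊗ a_{(0)_{<0>}} ⊗ a_{(1)} = a_{<-1>} ⊗ a_{<0>_{(0)}} ⊗ a_{<0>_{(1)}}` -/
  ρl_ρr : ∀ a,
    (sw (ρr a) fun a0 a1 => sw (ρl a0) fun m z => m ⊗ₜ[k] z ⊗ₜ[k] a1) =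
      sw (ρl a) fun m z => sw (ρr z) fun z0 z1 => m ⊗ₜ[k] z0 ⊗ₜ[k] z1
  /-- `a_{Q_{(0)}} ⊗ a_{Q_{(1)}} ⊗ b_Q = a_{(0)_Q} ⊗ a_{(1)} ⊗ b_Q` -/
  ρr_Q : ∀ a b,
    (sw (Q (a ⊗ₜ b)) fun aQ bQ => sw (ρr aQ) fun x0 x1 => x0 ⊗ₜ[k] x1 ⊗ₜ[k] bQ) =
      sw (ρr a) fun a0 a1 => sw (Q (a0 ⊗ₜ b)) fun a0Q bQ => a0Q ⊗ₜ[k] a1 ⊗ₜ[k] bQ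
  /-- `a_{R_{<-1>}} ⊗ a_{R_{<0>}} ⊗ b_R = a_{<-1>} ⊗ a_{<0>_R} ⊗ b_R` -/
  ρl_R : ∀ a b,
    (sw (R (b ⊗ₜ a)) fun aR bR => sw (ρl aR) fun m z => m ⊗ₜ[k] z ⊗ₜ[k] bR) =
      sw (ρl a) fun m z => sw (R (b ⊗ₜ z)) fun zR bR => m ⊗ₜ[k] zR ⊗ₜ[k] bR

/-- The compatibilities of `lamr a = a_{[0]} ⊗ a_{[1]}` and `laml a = a_{{-1}} ⊗ a_{{0}}` with
`R, Q, μl, μr, ρr, ρl`. -/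
structure TwistAxioms (R : B ⊗[k] A →ₗ[k] A ⊗[k] B) (Q : A ⊗[k] B →ₗ[k] A ⊗[k] B)
    (μl : B ⊗[k] A →ₗ[k] A) (μr : A ⊗[k] B →ₗ[k] A)
    (ρr : A →ₗ[k] A ⊗[k] B) (ρl : A →ₗ[k] B ⊗[k] A)
    (lamr : A →ₗ[k] A ⊗[k] B) (laml : A →ₗ[k] B ⊗[k] A) : Prop where
  lamr_one : lamr 1 = 1 ⊗ₜ 1
  laml_one : laml 1 = 1 ⊗ₜ 1
  /-- `a_{(0)_{[0]}} ⊗ a_{(0)_{[1]}} a_{(1)} = a ⊗ 1` -/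
  lamr_ρr : ∀ a,
    (sw (ρr a) fun a0 a1 => sw (lamr a0) fun l0 l1 => l0 ⊗ₜ[k] (l1 * a1)) = a ⊗ₜ 1
  /-- `a_{[0]_{(0)}} ⊗ a_{[0]_{(1)}} a_{[1]} = a ⊗ 1` -/
  ρr_lamr : ∀ a,
    (sw (lamr a) fun l0 l1 => sw (ρr l0) fun x0 x1 => x0 ⊗ₜ[k] (x1 * l1)) = a ⊗ₜ 1
  /-- `a_{<-1>} a_{<0>_{{-1}}} ⊗ a_{<0>_{{0}}} = 1 ⊗ a` -/
  laml_ρl : ∀ a,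
    (sw (ρl a) fun m z => sw (laml z) fun n w => (m * n) ⊗ₜ[k] w) = 1 ⊗ₜ a
  /-- `a_{{-1}} a_{{0}_{<-1>}} ⊗ a_{{0}_{<0>}} = 1 ⊗ a` -/
  ρl_laml : ∀ a,
    (sw (laml a) fun n w => sw (ρl w) fun m z => (n * m) ⊗ₜ[k] z) = 1 ⊗ₜ a
  /-- `a_{[0]_{{-1}}} ⊗ a_{[0]_{{0}}} ⊗ a_{[1]} = a_{{-1}} ⊗ a_{{0}_{[0]}} ⊗ a_{{0}_{[1]}}` -/
  laml_lamr : ∀ a,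
    (sw (lamr a) fun l0 l1 => sw (laml l0) fun n w => n ⊗ₜ[k] w ⊗ₜ[k] l1) =
      sw (laml a) fun n w => sw (lamr w) fun l0 l1 => n ⊗ₜ[k] l0 ⊗ₜ[k] l1
  /-- `a_{[0]_{<-1>}} ⊗ a_{[0]_{<0>}} ⊗ a_{[1]} = a_{<-1>} ⊗ a_{<0>_{[0]}} ⊗ a_{<0>_{[1]}}` -/
  ρl_lamr : ∀ a,
    (sw (lamr a) fun l0 l1 => sw (ρl l0) fun m z => m ⊗ₜ[k] z ⊗ₜ[k] l1) =
      sw (ρl a) fun m z => sw (lamr z) fun l0 l1 => m ⊗ₜ[k] l0 ⊗ₜ[k] l1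
  /-- `a_{(0)_{{-1}}} ⊗ a_{(0)_{{0}}} ⊗ a_{(1)} = a_{{-1}} ⊗ a_{{0}_{(0)}} ⊗ a_{{0}_{(1)}}` -/
  laml_ρr : ∀ a,
    (sw (ρr a) fun a0 a1 => sw (laml a0) fun n w => n ⊗ₜ[k] w ⊗ₜ[k] a1) =
      sw (laml a) fun n w => sw (ρr w) fun w0 w1 => n ⊗ₜ[k] w0 ⊗ₜ[k] w1
  /-- `λr (aa') = a_{[0]_{(0)}} (a_{[0]_{(1)}} · a'_{R_{[0]}}) ⊗ a'_{R_{[1]}} a_{[1]_R}` -/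
  lamr_mul : ∀ a a',
    lamr (a * a') =
      sw (lamr a) fun l0 l1 => sw (ρr l0) fun x0 x1 => sw (R (l1 ⊗ₜ a')) fun a'R l1R =>
        sw (lamr a'R) fun l'0 l'1 => (x0 * μl (x1 ⊗ₜ l'0)) ⊗ₜ (l'1 * l1R)
  /-- `λl (aa') = a'_{{-1}_Q} a_{Q_{{-1}}} ⊗ (a_{Q_{{0}}} · a'_{{0}_{<-1>}}) a'_{{0}_{<0>}}` -/
  laml_mul : ∀ a a',
    laml (a * a') =
      sw (laml a') fun n' w' => sw (Q (a ⊗ₜ n')) fun aQ n'Q => sw (laml aQ) fun n w =>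
        sw (ρl w') fun m' z' => (n'Q * n) ⊗ₜ (μr (w ⊗ₜ m') * z')
  /-- `ρl ((a · a'_{<-1>}) a'_{<0>}) = a_{<-1>} a'_{<-1>_Q} ⊗ a_{<0>_Q} a'_{<0>}` -/
  ρl_act : ∀ a a',
    ρl (sw (ρl a') fun m' z' => μr (a ⊗ₜ m') * z') =
      sw (ρl a) fun m z => sw (ρl a') fun m' z' => sw (Q (z ⊗ₜ m')) fun zQ m'Q =>
        (m * m'Q) ⊗ₜ (zQ * z')
  /-- `a_{(0)_{<-1>_R}} a'_{(1)_Q} ⊗ a_{(0)_{<0>_Q}} ⊗ a'_{(0)_{<0>_R}} ⊗ a'_{(0)_{<-1>}} ⊗ a_{(1)}`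
  `= a'_{(1)} a_{(0)_{<-1>}} ⊗ a_{(0)_{<0>}} ⊗ a'_{(0)_{<0>}} ⊗ a'_{(0)_{<-1>}} ⊗ a_{(1)}` -/
  exchange : ∀ a a',
    (sw (ρr a) fun a0 a1 => sw (ρl a0) fun m z => sw (ρr a') fun a'0 a'1 =>
      sw (ρl a'0) fun m' z' => sw (R (m ⊗ₜ z')) fun z'R mR => sw (Q (z ⊗ₜ a'1)) fun zQ a'1Q =>
        (mR * a'1Q) ⊗ₜ[k] zQ ⊗ₜ[k] z'R ⊗ₜ[k] m' ⊗ₜ[k] a1) =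
    sw (ρr a) fun a0 a1 => sw (ρl a0) fun m z => sw (ρr a') fun a'0 a'1 =>
      sw (ρl a'0) fun m' z' =>
        (a'1 * m) ⊗ₜ[k] z ⊗ₜ[k] z' ⊗ₜ[k] m' ⊗ₜ[k] a1
  /-- `a'_{<0>_{Q_{{-1}_R}}} a_{(1)} ⊗ a'_{<0>_{Q_{{0}}}} ⊗ a'_{<-1>} ⊗ a_{(0)_R} ⊗ b_Q`
  `= a_{(1)_q} a'_{<0>_{Q_{q_{{-1}}}}} ⊗ a'_{<0>_{Q_{q_{{0}}}}} ⊗ a'_{<-1>} ⊗ a_{(0)} ⊗ b_Q` -/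
  Q_laml_R : ∀ a a' b,
    (sw (ρr a) fun a0 a1 => sw (ρl a') fun m' z' => sw (Q (z' ⊗ₜ b)) fun z'Q bQ =>
      sw (laml z'Q) fun n w => sw (R (n ⊗ₜ a0)) fun a0R nR =>
        (nR * a1) ⊗ₜ[k] w ⊗ₜ[k] m' ⊗ₜ[k] a0R ⊗ₜ[k] bQ) =
    sw (ρr a) fun a0 a1 => sw (ρl a') fun m' z' => sw (Q (z' ⊗ₜ b)) fun z'Q bQ =>
      sw (Q (z'Q ⊗ₜ a1)) fun z'Qq a1q => sw (laml z'Qq) fun n w =>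
        (a1q * n) ⊗ₜ[k] w ⊗ₜ[k] m' ⊗ₜ[k] a0 ⊗ₜ[k] bQ
  /-- `a_{(0)_{R_{[0]}}} ⊗ a'_{<-1>} a_{(0)_{R_{[1]_Q}}} ⊗ a'_{<0>_Q} ⊗ a_{(1)} ⊗ b_R`
  `= a_{(0)_{r_{R_{[0]}}}} ⊗ a_{(0)_{r_{R_{[1]}}}} a'_{<-1>_R} ⊗ a'_{<0>} ⊗ a_{(1)} ⊗ b_r` -/
  R_lamr_Q : ∀ a a' b,
    (sw (ρr a) fun a0 a1 => sw (ρl a') fun m' z' => sw (R (b ⊗ₜ a0)) fun aR bR =>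
      sw (lamr aR) fun l0 l1 => sw (Q (z' ⊗ₜ l1)) fun z'Q l1Q =>
        l0 ⊗ₜ[k] (m' * l1Q) ⊗ₜ[k] z'Q ⊗ₜ[k] a1 ⊗ₜ[k] bR) =
    sw (ρr a) fun a0 a1 => sw (ρl a') fun m' z' => sw (R (b ⊗ₜ a0)) fun ar br =>
      sw (R (m' ⊗ₜ ar)) fun arR m'R => sw (lamr arR) fun l0 l1 =>
        l0 ⊗ₜ[k] (l1 * m'R) ⊗ₜ[k] z' ⊗ₜ[k] a1 ⊗ₜ[k] br
  /-- `a_{<0>_{Q_{{0}_{(0)_R}}}} ⊗ a_{<0>_{Q_{{0}_{(1)}}}} ⊗ a_{<-1>} ⊗ a_{<0>_{Q_{{-1}}}} ⊗ b_R ⊗ b'_Q`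
  `= a_{(0)_{R_{<0>_{Q_{{0}}}}}} ⊗ a_{(1)} ⊗ a_{(0)_{R_{<-1>}}} ⊗ a_{(0)_{R_{<0>_{Q_{{-1}}}}}} ⊗ b_R ⊗ b'_Q` -/
  Q_laml_ρr_R : ∀ a b b',
    (sw (ρl a) fun m z => sw (Q (z ⊗ₜ b')) fun zQ b'Q => sw (laml zQ) fun n w =>
      sw (ρr w) fun w0 w1 => sw (R (b ⊗ₜ w0)) fun w0R bR =>
        w0R ⊗ₜ[k] w1 ⊗ₜ[k] m ⊗ₜ[k] n ⊗ₜ[k] bR ⊗ₜ[k] b'Q) =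
    sw (ρr a) fun a0 a1 => sw (R (b ⊗ₜ a0)) fun aR bR => sw (ρl aR) fun m z =>
      sw (Q (z ⊗ₜ b')) fun zQ b'Q => sw (laml zQ) fun n w =>
        w ⊗ₜ[k] a1 ⊗ₜ[k] m ⊗ₜ[k] n ⊗ₜ[k] bR ⊗ₜ[k] b'Q
  /-- `a_{(0)_{R_{[1]}}} ⊗ a_{(0)_{R_{[0]_{<0>_Q}}}} ⊗ a_{(0)_{R_{[0]_{<-1>}}}} ⊗ a_{(1)} ⊗ b_R ⊗ b'_Q`
  `= a_{(0)_{<0>_{R_{Q_{[1]}}}}} ⊗ a_{(0)_{<0>_{R_{Q_{[0]}}}}} ⊗ a_{(0)_{<-1>}} ⊗ a_{(1)} ⊗ b_R ⊗ b'_Q` -/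
  R_lamr_ρl_Q : ∀ a b b',
    (sw (ρr a) fun a0 a1 => sw (R (b ⊗ₜ a0)) fun aR bR => sw (lamr aR) fun l0 l1 =>
      sw (ρl l0) fun m z => sw (Q (z ⊗ₜ b')) fun zQ b'Q =>
        l1 ⊗ₜ[k] zQ ⊗ₜ[k] m ⊗ₜ[k] a1 ⊗ₜ[k] bR ⊗ₜ[k] b'Q) =
    sw (ρr a) fun a0 a1 => sw (ρl a0) fun m z => sw (R (b ⊗ₜ z)) fun zR bR =>
      sw (Q (zR ⊗ₜ b')) fun zRQ b'Q => sw (lamr zRQ) fun l0 l1 =>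
        l1 ⊗ₜ[k] l0 ⊗ₜ[k] m ⊗ₜ[k] a1 ⊗ₜ[k] bR ⊗ₜ[k] b'Q
  /-- `(a₍₀₎·b')_{R_{[0]_{(0)}}} ⊗ (a₍₀₎·b')_{R_{[0]_{(1)}}} ⊗ (a₍₀₎·b')_{R_{[1]}} ⊗ b_R ⊗ a_{(1)}`
  `= a_{(0)_{R_{[0]_{(0)}}}}·b' ⊗ a_{(0)_{R_{[0]_{(1)}}}} ⊗ a_{(0)_{R_{[1]}}} ⊗ b_R ⊗ a_{(1)}` -/
  R_lamr_ρr_act : ∀ a b b',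
    (sw (ρr a) fun a0 a1 => sw (R (b ⊗ₜ μr (a0 ⊗ₜ b'))) fun u bR => sw (lamr u) fun l0 l1 =>
      sw (ρr l0) fun x0 x1 =>
        x0 ⊗ₜ[k] x1 ⊗ₜ[k] l1 ⊗ₜ[k] bR ⊗ₜ[k] a1) =
    sw (ρr a) fun a0 a1 => sw (R (b ⊗ₜ a0)) fun aR bR => sw (lamr aR) fun l0 l1 =>
      sw (ρr l0) fun x0 x1 =>
        μr (x0 ⊗ₜ b') ⊗ₜ[k] x1 ⊗ₜ[k] l1 ⊗ₜ[k] bR ⊗ₜ[k] a1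
  /-- `a'_{<-1>} ⊗ (b·a'_{<0>})_{Q_{{-1}}} ⊗ (b·a'_{<0>})_{Q_{{0}_{<-1>}}} ⊗ (b·a'_{<0>})_{Q_{{0}_{<0>}}} ⊗ b'_Q`
  `= a'_{<-1>} ⊗ a'_{<0>_{Q_{{-1}}}} ⊗ a'_{<0>_{Q_{{0}_{<-1>}}}} ⊗ b·a'_{<0>_{Q_{{0}_{<0>}}}} ⊗ b'_Q` -/
  Q_laml_ρl_act : ∀ a' b b',
    (sw (ρl a') fun m' z' => sw (Q (μl (b ⊗ₜ z') ⊗ₜ b')) fun u b'Q => sw (laml u) fun n w =>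
      sw (ρl w) fun m z =>
        m' ⊗ₜ[k] n ⊗ₜ[k] m ⊗ₜ[k] z ⊗ₜ[k] b'Q) =
    sw (ρl a') fun m' z' => sw (Q (z' ⊗ₜ b')) fun z'Q b'Q => sw (laml z'Q) fun n w =>
      sw (ρl w) fun m z =>
        m' ⊗ₜ[k] n ⊗ₜ[k] m ⊗ₜ[k] μl (b ⊗ₜ z) ⊗ₜ[k] b'Q

end Twist

end

end LRTwist

open LRTwist

open scoped TensorProduct

namespace LRTwist

noncomputable section

/-! The proof transports structure along `untwist ρr ρl`, the map of the theorem. It is bijective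
because λr and λl invert ρr and ρl up to a product in `B`; the inverse is the same formula with λ in
place of ρ (`untwist_lam_untwist`, `untwist_untwist_lam`). It also carries the product built from •,
R̃, Q̃ to the original one (`untwist_lrMul_tmul`): the λ's inside R̃ and Q̃ cancel against the ρ's
that the map creates on a • product, and what is left on the two sides differs exactly by the axiom
`exchange`.

This multiplicativity presupposes neither associativity of • nor any twisting axiom for R̃ and Q̃.
Hence associativity of the original product (`lrMul_assoc`) pulls back to the new one
(`tilde_assoc`). Evaluating it on elements a ⊗ 1 and 1 ⊗ b yields the multiplicativity axioms of R̃
and Q̃ (`IsLRTwisting.of_assoc`) and the associativity of • (`isAlgebraStructure_bullet`). Only the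
unit conditions and the two commutation relations (`tilde_comm_A`, `tilde_comm_B`) are checked
directly.

For the computations, each axiom between tensors is first turned into an identity of Sweedler sums
with an arbitrary multilinear summand, so that it applies under further sums. -/

/-- `F` is linear in each of its two variables. -/
structure IsBilinear (k : Type*) [Field k] {M N P : Type*} [AddCommMonoid M] [Module k M]
    [AddCommMonoid N] [Module k N] [AddCommMonoid P] [Module k P] (F : M → N → P) : Prop where
  left : ∀ y, IsLinearMap k fun x => F x y
  right : ∀ x, IsLinearMap k (F x)

/-! ### Functions linear in several variables -/

section Multilinear

variable (k : Type*) [Field k] {M₁ M₂ M₃ M₄ M₅ M₆ P : Type*} [AddCommMonoid M₁] [Module k M₁]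
  [AddCommMonoid M₂] [Module k M₂] [AddCommMonoid M₃] [Module k M₃] [AddCommMonoid M₄] [Module k M₄]
  [AddCommMonoid M₅] [Module k M₅] [AddCommMonoid M₆] [Module k M₆] [AddCommMonoid P] [Module k P]

/-- `F` is linear in each of its three variables. -/
structure IsTrilinear (F : M₁ → M₂ → M₃ → P) : Prop where
  fst : ∀ y z, IsLinearMap k fun x => F x y z
  snd : ∀ x z, IsLinearMap k fun y => F x y z
  thd : ∀ x y, IsLinearMap k (F x y)

/-- `F` is linear in each of its five variables. -/
structure IsQuintilinear (F : M₁ → M₂ → M₃ → M₄ → M₅ → P) : Prop where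
  fst : ∀ y z u v, IsLinearMap k fun x => F x y z u v
  snd : ∀ x z u v, IsLinearMap k fun y => F x y z u v
  trilinear : ∀ x y, IsTrilinear k (F x y)

/-- `F` is linear in each of its six variables. -/
structure IsSextilinear (F : M₁ → M₂ → M₃ → M₄ → M₅ → M₆ → P) : Prop where
  fst : ∀ y z u v w, IsLinearMap k fun x => F x y z u v w
  quintilinear : ∀ x, IsQuintilinear k (F x)

end Multilinear

/-- Linearity of expressions built from Sweedler sums, tensors, products and linear maps, in one
or in several variables. -/
theorem linearity {p : Prop} (h : p := by
    repeat' first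
      | intro _ | exact lin_id | apply lin_sw | apply lin_sw' | apply lin_tmul | apply lin_tmul'
      | apply lin_mul | apply lin_mul' | apply lin_app | apply lin_app₂ | apply IsBilinear.mk
      | apply IsTrilinear.mk | apply IsQuintilinear.mk | apply IsSextilinear.mk) : p :=
  h

/-! ### Calculus of Sweedler sums -/

section Sums

variable {k M N P V M' N' : Type*} [Field k]
  [AddCommMonoid M] [Module k M] [AddCommMonoid N] [Module k N]
  [AddCommMonoid P] [AddCommMonoid V] [AddCommMonoid M'] [Module k M']
  [AddCommMonoid N'] [Module k N']

theorem map_sw [Module k P] [Module k V] (L : P →ₗ[k] V) (t : M ⊗[k] N) (f : M → N → P) :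
    L (sw t f) = sw t fun x y => L (f x y) := by
  simp [sw]

theorem sw_apply [Module k P] [Module k V] (t : M ⊗[k] N) (f : M → N → P →ₗ[k] V) (v : P) :
    (sw t f) v = sw t fun x y => f x y v := by
  simp [sw]

theorem sw_congr {t : M ⊗[k] N} {f g : M → N → P} (h : ∀ x y, f x y = g x y) :
    sw t f = sw t g := by
  simp only [sw, h]

/-- Both sides are finite sums over independent index sets, so no linearity of `f` is required. -/
theorem sw_comm (t : M ⊗[k] N) (s : M' ⊗[k] N') (f : M → N → M' → N' → P) :
    (sw t fun x y => sw s fun u v => f x y u v) = sw s fun u v => sw t fun x y => f x y u v := by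
  simp only [sw]
  exact Finset.sum_comm

/-- Bilinearity is essential: the expression chosen for `sw t g` is unrelated to those chosen for
`t` and for the `g x y`. -/
theorem sw_sw [Module k P] (t : M ⊗[k] N) (g : M → N → M' ⊗[k] N') (f : M' → N' → P)
    (hf : IsBilinear k f) :
    sw (sw t g) f = sw t fun x y => sw (g x y) f := by
  simp only [sw_eq_lift_mk f hf.left hf.right, map_sw]

end Sums

/-! ### Associativity of an L-R-twisted tensor product -/

section Twisting

variable {k A B P : Type*} [Field k] [AddCommMonoid A] [Module k A] [AddCommMonoid B] [Module k B]
  [AddCommMonoid P] [Module k P]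
  {mA : A →ₗ[k] A →ₗ[k] A} {eA : A} {mB : B →ₗ[k] B →ₗ[k] B} {eB : B}
  {R : B ⊗[k] A →ₗ[k] A ⊗[k] B} {Q : A ⊗[k] B →ₗ[k] A ⊗[k] B}

theorem lrMul_tmul (a : A) (b : B) (a' : A) (b' : B) :
    lrMul mA mB R Q (a ⊗ₜ b) (a' ⊗ₜ b') =
      sw (Q (a ⊗ₜ b')) fun aQ b'Q => sw (R (b ⊗ₜ a')) fun a'R bR => mA aQ a'R ⊗ₜ mB bR b'Q := by
  simp (disch := exact linearity) only [lrMul, bilin, LinearMap.mk₂_apply, sw_tmul]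

namespace IsLRTwisting

theorem sw_R_mul_left (h : IsLRTwisting mA eA mB eB R Q) (F : A → B → P)
    (hF : IsBilinear k F) (a a' : A) (b : B) :
    sw (R (b ⊗ₜ mA a a')) F =
      sw (R (b ⊗ₜ a)) fun aR bR => sw (R (bR ⊗ₜ a')) fun a'r bRr => F (mA aR a'r) bRr := by
  rw [h.R_mul_left]
  simp only [sw_sw _ _ _ hF, sw_tmul _ hF.left hF.right]

theorem sw_R_mul_right (h : IsLRTwisting mA eA mB eB R Q) (F : A → B → P)
    (hF : IsBilinear k F) (a : A) (b b' : B) :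
    sw (R (mB b b' ⊗ₜ a)) F =
      sw (R (b' ⊗ₜ a)) fun aR b'R => sw (R (b ⊗ₜ aR)) fun aRr br => F aRr (mB br b'R) := by
  rw [h.R_mul_right]
  simp only [sw_sw _ _ _ hF, sw_tmul _ hF.left hF.right]

theorem sw_Q_mul_left (h : IsLRTwisting mA eA mB eB R Q) (F : A → B → P)
    (hF : IsBilinear k F) (a a' : A) (b : B) :
    sw (Q (mA a a' ⊗ₜ b)) F =
      sw (Q (a' ⊗ₜ b)) fun a'Q bQ => sw (Q (a ⊗ₜ bQ)) fun aq bQq => F (mA aq a'Q) bQq := by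
  rw [h.Q_mul_left]
  simp only [sw_sw _ _ _ hF, sw_tmul _ hF.left hF.right]

theorem sw_Q_mul_right (h : IsLRTwisting mA eA mB eB R Q) (F : A → B → P)
    (hF : IsBilinear k F) (a : A) (b b' : B) :
    sw (Q (a ⊗ₜ mB b b')) F =
      sw (Q (a ⊗ₜ b)) fun aQ bQ => sw (Q (aQ ⊗ₜ b')) fun aQq b'q => F aQq (mB bQ b'q) := by
  rw [h.Q_mul_right]
  simp only [sw_sw _ _ _ hF, sw_tmul _ hF.left hF.right]

end IsLRTwisting

section Trilinear

variable {M N L : Type*} [AddCommMonoid M] [Module k M] [AddCommMonoid N] [Module k N]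
  [AddCommMonoid L] [Module k L]

/-- The linear map on a threefold tensor product given by a function that is linear in each of
its three variables. -/
def trilin (F : M → N → L → P) (hF : IsTrilinear k F) :
    M ⊗[k] N ⊗[k] L →ₗ[k] P :=
  TensorProduct.lift <| bilin (fun t z => sw t fun x y => F x y z)
    (fun z => lin_sw lin_id (hF.fst · z) (hF.snd · z)) (fun _ => lin_sw' hF.thd)

theorem trilin_tmul (F : M → N → L → P) (hF : IsTrilinear k F) (x : M) (y : N)
    (z : L) : trilin F hF (x ⊗ₜ y ⊗ₜ z) = F x y z := by
  simp only [trilin, bilin, TensorProduct.lift.tmul, LinearMap.mk₂_apply]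
  exact sw_tmul _ (hF.fst · z) (hF.snd · z) x y

end Trilinear

namespace IsLRTwisting

/-- The tensor identity is mapped through the linear map `trilin F hF`; in this form it can be
applied inside larger sums. The later `sw_` lemmas drawn from tensor identities follow the same
pattern. -/
theorem sw_comm_A (h : IsLRTwisting mA eA mB eB R Q) (F : B → A → B → P)
    (hF : IsTrilinear k F) (a : A) (b b' : B) :
    (sw (R (b ⊗ₜ a)) fun aR bR => sw (Q (aR ⊗ₜ b')) fun aRQ b'Q => F bR aRQ b'Q) =
      sw (Q (a ⊗ₜ b')) fun aQ b'Q => sw (R (b ⊗ₜ aQ)) fun aQR bR => F bR aQR b'Q := by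
  simpa only [map_sw, trilin_tmul] using congrArg (trilin F hF) (h.comm_A a b b')

theorem sw_comm_B (h : IsLRTwisting mA eA mB eB R Q) (F : A → B → A → P)
    (hF : IsTrilinear k F) (a a' : A) (b : B) :
    (sw (R (b ⊗ₜ a)) fun aR bR => sw (Q (a' ⊗ₜ bR)) fun a'Q bRQ => F aR bRQ a'Q) =
      sw (Q (a' ⊗ₜ b)) fun a'Q bQ => sw (R (bQ ⊗ₜ a)) fun aR bQR => F aR bQR a'Q := by
  simpa only [map_sw, trilin_tmul] using congrArg (trilin F hF) (h.comm_B a a' b)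

theorem lrMul_assoc (h : IsLRTwisting mA eA mB eB R Q) (hA : IsAlgebraStructure mA eA)
    (hB : IsAlgebraStructure mB eB) (x y z : A ⊗[k] B) :
    lrMul mA mB R Q (lrMul mA mB R Q x y) z = lrMul mA mB R Q x (lrMul mA mB R Q y z) := by
  induction x with
  | zero => simp
  | add x x' hx hx' => simp only [map_add, LinearMap.add_apply, hx, hx']
  | tmul a b =>
  induction y with
  | zero => simp
  | add x x' hx hx' => simp only [map_add, LinearMap.add_apply, hx, hx']
  | tmul a' b' =>
  induction z with
  | zero => simp
  | add x x' hx hx' => simp only [map_add, hx, hx']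
  | tmul a'' b'' =>
  -- Both bracketings are split until `R` and `Q` act on single factors. They then differ in two
  -- places: the order of `R` and `Q` acting on `a'`, and the order of `R` and `Q` acting on `b'`.
  simp (disch := exact linearity) only [lrMul_tmul, map_sw, sw_apply, h.sw_Q_mul_left,
    h.sw_Q_mul_right, h.sw_R_mul_left, h.sw_R_mul_right, hA.mul_assoc, hB.mul_assoc]
  simp only [sw_comm _ (R (b ⊗ₜ a'))]
  simp only [sw_comm (Q (a ⊗ₜ b'))]
  -- This settles the action on `a'`: `R (b ⊗ a')` followed by `Q` with `b''` becomes `Q (a' ⊗ b'')`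
  -- followed by `R` with `b`.
  simp (disch := exact linearity) only [h.sw_comm_A]
  refine sw_congr fun x y => ?_
  simp only [sw_comm _ (R (b ⊗ₜ x))]
  refine sw_congr fun z w => ?_
  -- The remaining discrepancy is on `b'`, which meets `a''` through `R` and `a` through `Q`.
  simp (disch := exact linearity) only [h.sw_comm_B _ _ a'' a]
  refine sw_congr fun _ _ => ?_
  exact sw_comm _ _ _

theorem isAlgebraStructure (h : IsLRTwisting mA eA mB eB R Q) (hA : IsAlgebraStructure mA eA)
    (hB : IsAlgebraStructure mB eB) :
    IsAlgebraStructure (lrMul mA mB R Q) (eA ⊗ₜ eB) where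
  mul_assoc := h.lrMul_assoc hA hB
  one_mul x := by
    induction x with
    | zero => simp
    | add x x' hx hx' => simp only [map_add, hx, hx']
    | tmul a b =>
      simp (disch := exact linearity) only [lrMul_tmul, h.Q_one_left, h.R_one_left, sw_tmul,
        hA.one_mul, hB.one_mul]
  mul_one x := by
    induction x with
    | zero => simp
    | add x x' hx hx' => simp only [map_add, LinearMap.add_apply, hx, hx']
    | tmul a b =>
      simp (disch := exact linearity) only [lrMul_tmul, h.Q_one_right, h.R_one_right, sw_tmul,
        hA.mul_one, hB.mul_one]
end IsLRTwisting
end Twisting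

/-! ### Linear maps on five- and sixfold tensor products -/

section Multilinear

variable {k M₁ M₂ M₃ M₄ M₅ M₆ P : Type*} [Field k] [AddCommMonoid M₁] [Module k M₁]
  [AddCommMonoid M₂] [Module k M₂] [AddCommMonoid M₃] [Module k M₃] [AddCommMonoid M₄] [Module k M₄]
  [AddCommMonoid M₅] [Module k M₅] [AddCommMonoid M₆] [Module k M₆] [AddCommMonoid P] [Module k P]

/-- The linear map on a fivefold tensor product given by a function that is linear in each of
its variables. -/
def quintlin (F : M₁ → M₂ → M₃ → M₄ → M₅ → P)
    (hF : IsQuintilinear k F) :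
    M₁ ⊗[k] M₂ ⊗[k] M₃ ⊗[k] M₄ ⊗[k] M₅ →ₗ[k] P :=
  trilin (fun t u v => sw t fun s z => sw s fun x y => F x y z u v)
    ⟨fun u v => lin_sw lin_id
      (fun z => lin_sw lin_id (hF.fst · z u v) (hF.snd · z u v))
      (fun _ => lin_sw' fun x y => (hF.trilinear x y).fst u v),
    fun _ v => lin_sw' fun _ z => lin_sw' fun x y => (hF.trilinear x y).snd z v,
    fun _ u => lin_sw' fun _ z => lin_sw' fun x y => (hF.trilinear x y).thd z u⟩

theorem quintlin_tmul (F : M₁ → M₂ → M₃ → M₄ → M₅ → P)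
    (hF : IsQuintilinear k F) (x : M₁) (y : M₂) (z : M₃) (u : M₄) (v : M₅) :
    quintlin F hF (x ⊗ₜ y ⊗ₜ z ⊗ₜ u ⊗ₜ v) = F x y z u v := by
  rw [quintlin, trilin_tmul, sw_tmul _
    (fun z => lin_sw lin_id (hF.fst · z u v) (hF.snd · z u v))
    (fun _ => lin_sw' fun x y => (hF.trilinear x y).fst u v),
    sw_tmul _ (hF.fst · z u v) (hF.snd · z u v)]

/-- The linear map on a sixfold tensor product given by a function that is linear in each of
its variables. -/
def sextlin (F : M₁ → M₂ → M₃ → M₄ → M₅ → M₆ → P)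
    (hF : IsSextilinear k F) :
    M₁ ⊗[k] M₂ ⊗[k] M₃ ⊗[k] M₄ ⊗[k] M₅ ⊗[k] M₆ →ₗ[k] P :=
  quintlin (fun t z u v w => sw t fun x y => F x y z u v w)
    ⟨fun z u v w => lin_sw lin_id (hF.fst · z u v w) (fun y => (hF.quintilinear y).fst z u v w),
    fun _ u v w => lin_sw' fun x y => (hF.quintilinear x).snd y u v w,
    fun _ _ => ⟨fun v w => lin_sw' fun x y => ((hF.quintilinear x).trilinear y _).fst v w,
      fun u w => lin_sw' fun x y => ((hF.quintilinear x).trilinear y _).snd u w,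
      fun u v => lin_sw' fun x y => ((hF.quintilinear x).trilinear y _).thd u v⟩⟩

theorem sextlin_tmul (F : M₁ → M₂ → M₃ → M₄ → M₅ → M₆ → P)
    (hF : IsSextilinear k F)
    (x : M₁) (y : M₂) (z : M₃) (u : M₄) (v : M₅) (w : M₆) :
    sextlin F hF (x ⊗ₜ y ⊗ₜ z ⊗ₜ u ⊗ₜ v ⊗ₜ w) = F x y z u v w := by
  rw [sextlin, quintlin_tmul, sw_tmul _ (hF.fst · z u v w)
    (fun y => (hF.quintilinear y).fst z u v w)]

end Multilinear

/-! ### The axioms as identities of Sweedler sums -/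

section Twist

variable {k A B P : Type*} [Field k] [Ring A] [Algebra k A] [Ring B] [Algebra k B]
  [AddCommMonoid P] [Module k P]
  {R : B ⊗[k] A →ₗ[k] A ⊗[k] B} {Q : A ⊗[k] B →ₗ[k] A ⊗[k] B}
  {μl : B ⊗[k] A →ₗ[k] A} {μr : A ⊗[k] B →ₗ[k] A}
  {ρr : A →ₗ[k] A ⊗[k] B} {ρl : A →ₗ[k] B ⊗[k] A}
  {lamr : A →ₗ[k] A ⊗[k] B} {laml : A →ₗ[k] B ⊗[k] A}

theorem sw_tildeR (F : A → B → P) (hF : IsBilinear k F) (a : A) (b : B) :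
    sw (tildeR R ρr lamr (b ⊗ₜ a)) F =
      sw (ρr a) fun a0 a1 => sw (R (b ⊗ₜ a0)) fun aR bR => sw (lamr aR) fun l0 l1 =>
        F l0 (l1 * bR * a1) := by
  simp only [tildeR, bilin, TensorProduct.lift.tmul, LinearMap.mk₂_apply, sw_sw _ _ _ hF,
    sw_tmul _ hF.left hF.right]

theorem sw_tildeQ (F : A → B → P) (hF : IsBilinear k F) (a : A) (b : B) :
    sw (tildeQ Q ρl laml (a ⊗ₜ b)) F =
      sw (ρl a) fun m z => sw (Q (z ⊗ₜ b)) fun zQ bQ => sw (laml zQ) fun n w =>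
        F w (m * bQ * n) := by
  simp only [tildeQ, bilin, TensorProduct.lift.tmul, LinearMap.mk₂_apply, sw_sw _ _ _ hF,
    sw_tmul _ hF.left hF.right]

theorem bullet_apply (a a' : A) : bullet μl μr ρr ρl a a' =
    sw (ρr a) fun a0 a1 => sw (ρl a') fun m' z' => μr (a0 ⊗ₜ m') * μl (a1 ⊗ₜ z') := by
  simp only [bullet, bilin, LinearMap.mk₂_apply]

namespace IsLRTwisting

/-- The special case of `sw_R_mul_right` with the product written as `*`, the shape in which it
occurs in the expansions of R̃, Q̃ and `untwist`. -/
theorem sw_R_mul (h : IsLRTwisting (LinearMap.mul k A) 1 (LinearMap.mul k B) 1 R Q)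
    (F : A → B → P) (hF : IsBilinear k F) (a : A) (b b' : B) : sw (R ((b * b') ⊗ₜ a)) F =
      sw (R (b' ⊗ₜ a)) fun aR b'R => sw (R (b ⊗ₜ aR)) fun aRr br => F aRr (br * b'R) :=
  h.sw_R_mul_right F hF a b b'

theorem sw_Q_mul (h : IsLRTwisting (LinearMap.mul k A) 1 (LinearMap.mul k B) 1 R Q)
    (F : A → B → P) (hF : IsBilinear k F) (a : A) (b b' : B) : sw (Q (a ⊗ₜ (b * b'))) F =
      sw (Q (a ⊗ₜ b)) fun aQ bQ => sw (Q (aQ ⊗ₜ b')) fun aQq b'q => F aQq (bQ * b'q) :=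
  h.sw_Q_mul_right F hF a b b'

end IsLRTwisting

namespace BulletAxioms

theorem sw_ρr_bullet (h : BulletAxioms R Q μl μr ρr ρl) (F : A → B → P)
    (hF : IsBilinear k F) (a a' : A) :
    sw (ρr (bullet μl μr ρr ρl a a')) F =
      sw (ρr a) fun a0 a1 => sw (ρr a') fun a'0 a'1 => sw (R (a1 ⊗ₜ a'0)) fun a'R a1R =>
        sw (ρl a'R) fun m z => F (μr (a0 ⊗ₜ m) * z) (a1R * a'1) := by
  simp only [h.ρr_bullet, sw_sw _ _ _ hF, sw_tmul _ hF.left hF.right]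

theorem sw_ρl_ρr (h : BulletAxioms R Q μl μr ρr ρl) (F : B → A → B → P)
    (hF : IsTrilinear k F) (a : A) :
    (sw (ρr a) fun a0 a1 => sw (ρl a0) fun m z => F m z a1) =
      sw (ρl a) fun m z => sw (ρr z) fun z0 z1 => F m z0 z1 := by
  simpa only [map_sw, trilin_tmul] using congrArg (trilin F hF) (h.ρl_ρr a)

theorem sw_ρr_Q (h : BulletAxioms R Q μl μr ρr ρl) (F : A → B → B → P)
    (hF : IsTrilinear k F) (a : A) (b : B) :
    (sw (Q (a ⊗ₜ b)) fun aQ bQ => sw (ρr aQ) fun x0 x1 => F x0 x1 bQ) =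
      sw (ρr a) fun a0 a1 => sw (Q (a0 ⊗ₜ b)) fun a0Q bQ => F a0Q a1 bQ := by
  simpa only [map_sw, trilin_tmul] using congrArg (trilin F hF) (h.ρr_Q a b)

theorem sw_ρl_R (h : BulletAxioms R Q μl μr ρr ρl) (F : B → A → B → P)
    (hF : IsTrilinear k F) (a : A) (b : B) :
    (sw (R (b ⊗ₜ a)) fun aR bR => sw (ρl aR) fun m z => F m z bR) =
      sw (ρl a) fun m z => sw (R (b ⊗ₜ z)) fun zR bR => F m zR bR := by
  simpa only [map_sw, trilin_tmul] using congrArg (trilin F hF) (h.ρl_R a b)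

theorem bullet_one (h : BulletAxioms R Q μl μr ρr ρl) (a : A) : bullet μl μr ρr ρl a 1 = a := by
  simp (disch := exact linearity) only [bullet_apply, h.ρl_one, sw_tmul, h.act_one,
    h.ρr_act_one]

theorem one_bullet (h : BulletAxioms R Q μl μr ρr ρl) (a : A) : bullet μl μr ρr ρl 1 a = a := by
  simp (disch := exact linearity) only [bullet_apply, h.ρr_one, sw_tmul, h.one_act,
    h.ρl_one_act]

end BulletAxioms

namespace TwistAxioms

theorem sw_lamr_ρr (h : TwistAxioms R Q μl μr ρr ρl lamr laml) (F : A → B → P)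
    (hF : IsBilinear k F) (a : A) :
    (sw (ρr a) fun a0 a1 => sw (lamr a0) fun l0 l1 => F l0 (l1 * a1)) = F a 1 := by
  simpa only [sw_sw _ _ _ hF, sw_tmul _ hF.left hF.right] using congrArg (sw · F) (h.lamr_ρr a)

theorem sw_ρr_lamr (h : TwistAxioms R Q μl μr ρr ρl lamr laml) (F : A → B → P)
    (hF : IsBilinear k F) (a : A) :
    (sw (lamr a) fun l0 l1 => sw (ρr l0) fun x0 x1 => F x0 (x1 * l1)) = F a 1 := by
  simpa only [sw_sw _ _ _ hF, sw_tmul _ hF.left hF.right] using congrArg (sw · F) (h.ρr_lamr a)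

theorem sw_laml_ρl (h : TwistAxioms R Q μl μr ρr ρl lamr laml) (F : B → A → P)
    (hF : IsBilinear k F) (a : A) :
    (sw (ρl a) fun m z => sw (laml z) fun n w => F (m * n) w) = F 1 a := by
  simpa only [sw_sw _ _ _ hF, sw_tmul _ hF.left hF.right] using congrArg (sw · F) (h.laml_ρl a)

theorem sw_ρl_laml (h : TwistAxioms R Q μl μr ρr ρl lamr laml) (F : B → A → P)
    (hF : IsBilinear k F) (a : A) :
    (sw (laml a) fun n w => sw (ρl w) fun m z => F (n * m) z) = F 1 a := by
  simpa only [sw_sw _ _ _ hF, sw_tmul _ hF.left hF.right] using congrArg (sw · F) (h.ρl_laml a)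

theorem sw_laml_lamr (h : TwistAxioms R Q μl μr ρr ρl lamr laml) (F : B → A → B → P)
    (hF : IsTrilinear k F) (a : A) :
    (sw (lamr a) fun l0 l1 => sw (laml l0) fun n w => F n w l1) =
      sw (laml a) fun n w => sw (lamr w) fun l0 l1 => F n l0 l1 := by
  simpa only [map_sw, trilin_tmul] using congrArg (trilin F hF) (h.laml_lamr a)

theorem sw_laml_ρr (h : TwistAxioms R Q μl μr ρr ρl lamr laml) (F : B → A → B → P)
    (hF : IsTrilinear k F) (a : A) :
    (sw (ρr a) fun a0 a1 => sw (laml a0) fun n w => F n w a1) =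
      sw (laml a) fun n w => sw (ρr w) fun w0 w1 => F n w0 w1 := by
  simpa only [map_sw, trilin_tmul] using congrArg (trilin F hF) (h.laml_ρr a)

theorem sw_ρl_act (h : TwistAxioms R Q μl μr ρr ρl lamr laml) (F : B → A → P)
    (hF : IsBilinear k F) (a a' : A) :
    (sw (ρl a') fun m' z' => sw (ρl (μr (a ⊗ₜ m') * z')) F) =
      sw (ρl a) fun m z => sw (ρl a') fun m' z' => sw (Q (z ⊗ₜ m')) fun zQ m'Q =>
        F (m * m'Q) (zQ * z') := by
  simpa only [map_sw, sw_sw _ _ _ hF, sw_tmul _ hF.left hF.right] using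
    congrArg (sw · F) (h.ρl_act a a')

theorem sw_exchange (h : TwistAxioms R Q μl μr ρr ρl lamr laml) (F : B → A → A → B → B → P)
    (hF : IsQuintilinear k F) (a a' : A) :
    (sw (ρr a) fun a0 a1 => sw (ρl a0) fun m z => sw (ρr a') fun a'0 a'1 =>
      sw (ρl a'0) fun m' z' => sw (R (m ⊗ₜ z')) fun z'R mR => sw (Q (z ⊗ₜ a'1)) fun zQ a'1Q =>
        F (mR * a'1Q) zQ z'R m' a1) =
    sw (ρr a) fun a0 a1 => sw (ρl a0) fun m z => sw (ρr a') fun a'0 a'1 =>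
      sw (ρl a'0) fun m' z' => F (a'1 * m) z z' m' a1 := by
  simpa only [map_sw, quintlin_tmul] using congrArg (quintlin F hF) (h.exchange a a')

theorem sw_Q_laml_R (h : TwistAxioms R Q μl μr ρr ρl lamr laml) (F : B → A → B → A → B → P)
    (hF : IsQuintilinear k F) (a a' : A) (b : B) :
    (sw (ρr a) fun a0 a1 => sw (ρl a') fun m' z' => sw (Q (z' ⊗ₜ b)) fun z'Q bQ =>
      sw (laml z'Q) fun n w => sw (R (n ⊗ₜ a0)) fun a0R nR => F (nR * a1) w m' a0R bQ) =
    sw (ρr a) fun a0 a1 => sw (ρl a') fun m' z' => sw (Q (z' ⊗ₜ b)) fun z'Q bQ =>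
      sw (Q (z'Q ⊗ₜ a1)) fun z'Qq a1q => sw (laml z'Qq) fun n w => F (a1q * n) w m' a0 bQ := by
  simpa only [map_sw, quintlin_tmul] using
    congrArg (quintlin F hF) (h.Q_laml_R a a' b)

theorem sw_R_lamr_Q (h : TwistAxioms R Q μl μr ρr ρl lamr laml) (F : A → B → A → B → B → P)
    (hF : IsQuintilinear k F) (a a' : A) (b : B) :
    (sw (ρr a) fun a0 a1 => sw (ρl a') fun m' z' => sw (R (b ⊗ₜ a0)) fun aR bR =>
      sw (lamr aR) fun l0 l1 => sw (Q (z' ⊗ₜ l1)) fun z'Q l1Q => F l0 (m' * l1Q) z'Q a1 bR) =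
    sw (ρr a) fun a0 a1 => sw (ρl a') fun m' z' => sw (R (b ⊗ₜ a0)) fun ar br =>
      sw (R (m' ⊗ₜ ar)) fun arR m'R => sw (lamr arR) fun l0 l1 => F l0 (l1 * m'R) z' a1 br := by
  simpa only [map_sw, quintlin_tmul] using
    congrArg (quintlin F hF) (h.R_lamr_Q a a' b)

theorem sw_Q_laml_ρr_R (h : TwistAxioms R Q μl μr ρr ρl lamr laml)
    (F : A → B → B → B → B → B → P)
    (hF : IsSextilinear k F) (a : A) (b b' : B) :
    (sw (ρl a) fun m z => sw (Q (z ⊗ₜ b')) fun zQ b'Q => sw (laml zQ) fun n w =>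
      sw (ρr w) fun w0 w1 => sw (R (b ⊗ₜ w0)) fun w0R bR => F w0R w1 m n bR b'Q) =
    sw (ρr a) fun a0 a1 => sw (R (b ⊗ₜ a0)) fun aR bR => sw (ρl aR) fun m z =>
      sw (Q (z ⊗ₜ b')) fun zQ b'Q => sw (laml zQ) fun n w => F w a1 m n bR b'Q := by
  simpa only [map_sw, sextlin_tmul] using
    congrArg (sextlin F hF) (h.Q_laml_ρr_R a b b')

theorem sw_R_lamr_ρl_Q (h : TwistAxioms R Q μl μr ρr ρl lamr laml)
    (F : B → A → B → B → B → B → P)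
    (hF : IsSextilinear k F) (a : A) (b b' : B) :
    (sw (ρr a) fun a0 a1 => sw (R (b ⊗ₜ a0)) fun aR bR => sw (lamr aR) fun l0 l1 =>
      sw (ρl l0) fun m z => sw (Q (z ⊗ₜ b')) fun zQ b'Q => F l1 zQ m a1 bR b'Q) =
    sw (ρr a) fun a0 a1 => sw (ρl a0) fun m z => sw (R (b ⊗ₜ z)) fun zR bR =>
      sw (Q (zR ⊗ₜ b')) fun zRQ b'Q => sw (lamr zRQ) fun l0 l1 => F l1 l0 m a1 bR b'Q := by
  simpa only [map_sw, sextlin_tmul] using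
    congrArg (sextlin F hF) (h.R_lamr_ρl_Q a b b')

end TwistAxioms

/-! ### The isomorphism -/

/-- The map `a ⊗ b ↦ a_{(0)_{<0>}} ⊗ a_{(1)} b a_{(0)_{<-1>}}`. -/
def untwist (ρr : A →ₗ[k] A ⊗[k] B) (ρl : A →ₗ[k] B ⊗[k] A) : A ⊗[k] B →ₗ[k] A ⊗[k] B :=
  TensorProduct.lift <| bilin
    (fun a b => sw (ρr a) fun a0 a1 => sw (ρl a0) fun m z => z ⊗ₜ (a1 * b * m))
    linearity linearity

theorem untwist_tmul (a : A) (b : B) : untwist ρr ρl (a ⊗ₜ b) =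
    sw (ρr a) fun a0 a1 => sw (ρl a0) fun m z => z ⊗ₜ (a1 * b * m) := by
  simp only [untwist, bilin, TensorProduct.lift.tmul, LinearMap.mk₂_apply]

/-- By `ρl_ρr` the coaction ρl may be taken before ρr. Then λr directly follows ρr and cancels it by
`lamr_ρr` on the left of `b`, after which λl follows ρl and cancels it by `laml_ρl` on the right. -/
theorem TwistAxioms.untwist_lam_untwist (hb : BulletAxioms R Q μl μr ρr ρl)
    (h : TwistAxioms R Q μl μr ρr ρl lamr laml) :
    untwist lamr laml ∘ₗ untwist ρr ρl = LinearMap.id := by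
  ext a b
  simp (disch := exact linearity) only
    [TensorProduct.AlgebraTensorModule.curry_apply, LinearMap.restrictScalars_self,
      TensorProduct.curry_apply, LinearMap.comp_apply, LinearMap.id_apply, untwist_tmul, map_sw,
      hb.sw_ρl_ρr]
  have e₁ (m : B) (z : A) := h.sw_lamr_ρr
    (fun x p => sw (laml x) fun n w => w ⊗ₜ[k] (p * (b * (m * n)))) linearity z
  have e₂ := h.sw_laml_ρl (fun p x => x ⊗ₜ[k] (b * p)) linearity a
  simp only [mul_assoc, one_mul, mul_one] at e₁ e₂ ⊢
  simp only [e₁, e₂]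

/-- The same cancellation in the other order, with `laml_ρr` used to bring ρr next to λr. -/
theorem TwistAxioms.untwist_untwist_lam
    (h : TwistAxioms R Q μl μr ρr ρl lamr laml) :
    untwist ρr ρl ∘ₗ untwist lamr laml = LinearMap.id := by
  ext a b
  simp (disch := exact linearity) only
    [TensorProduct.AlgebraTensorModule.curry_apply, LinearMap.restrictScalars_self,
      TensorProduct.curry_apply, LinearMap.comp_apply, LinearMap.id_apply, untwist_tmul, map_sw,
      ← h.sw_laml_ρr]
  have e₁ := h.sw_ρr_lamr
    (fun x p => sw (laml x) fun n w => sw (ρl w) fun m z => z ⊗ₜ[k] (p * (b * (n * m))))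
    linearity a
  have e₂ := h.sw_ρl_laml (fun p x => x ⊗ₜ[k] (b * p)) linearity a
  simp only [mul_assoc, one_mul, mul_one] at e₁ e₂ ⊢
  simp only [e₁, e₂]

theorem lrMul_mul_tmul (m : A →ₗ[k] A →ₗ[k] A) (a : A) (b : B) (a' : A) (b' : B) :
    lrMul m (LinearMap.mul k B) R Q (a ⊗ₜ b) (a' ⊗ₜ b') =
      sw (Q (a ⊗ₜ b')) fun aQ b'Q => sw (R (b ⊗ₜ a')) fun a'R bR => m aQ a'R ⊗ₜ (bR * b'Q) :=
  lrMul_tmul a b a' b'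

theorem lrMul_mul_mul_tmul (a : A) (b : B) (a' : A) (b' : B) :
    lrMul (LinearMap.mul k A) (LinearMap.mul k B) R Q (a ⊗ₜ b) (a' ⊗ₜ b') =
      sw (Q (a ⊗ₜ b')) fun aQ b'Q => sw (R (b ⊗ₜ a')) fun a'R bR => (aQ * a'R) ⊗ₜ (bR * b'Q) :=
  lrMul_tmul a b a' b'

/-! ### Multiplicativity of the isomorphism; commutation of R̃ and Q̃ -/

namespace TwistAxioms

/-- `ρr_bullet` leaves a first leg of the form (a₍₀₎ · m) z with m ⊗ z in the image of ρl, which is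
what `ρl_act` can expand; `ρl_R` then moves the coaction inside `R`. -/
theorem untwist_bullet (hb : BulletAxioms R Q μl μr ρr ρl)
    (h : TwistAxioms R Q μl μr ρr ρl lamr laml) (a a' : A) (c : B) :
    untwist ρr ρl (bullet μl μr ρr ρl a a' ⊗ₜ c) =
      sw (ρr a) fun a0 a1 => sw (ρl a0) fun m z => sw (ρr a') fun a'0 a'1 =>
        sw (ρl a'0) fun m' z' => sw (R (a1 ⊗ₜ z')) fun z'R a1R => sw (Q (z ⊗ₜ m')) fun zQ m'Q =>
          (zQ * z'R) ⊗ₜ (a1R * (a'1 * (c * (m * m'Q)))) := by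
  simp (disch := exact linearity) only [untwist_tmul, hb.sw_ρr_bullet]
  have e (a0 a'R : A) (a1R a'1 : B) := h.sw_ρl_act (fun m z => z ⊗ₜ[k] (a1R * a'1 * c * m))
    linearity a0 a'R
  simp only [e]
  simp only [sw_comm (R _) (ρl _), sw_comm (ρr a') (ρl _)]
  simp (disch := exact linearity) only [hb.sw_ρl_R, mul_assoc]

/-- In `untwist_bullet` the element `a'₍₁₎` stands just left of `c`, so λr applied to the second
argument cancels ρr by `ρr_lamr`. -/
theorem lamr_untwist_bullet (hb : BulletAxioms R Q μl μr ρr ρl)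
    (h : TwistAxioms R Q μl μr ρr ρl lamr laml) (a a' : A) (c : B) :
    (sw (lamr a') fun l0 l1 => untwist ρr ρl (bullet μl μr ρr ρl a l0 ⊗ₜ (l1 * c))) =
      sw (ρr a) fun a0 a1 => sw (ρl a0) fun m z =>
        sw (ρl a') fun m' z' => sw (R (a1 ⊗ₜ z')) fun z'R a1R => sw (Q (z ⊗ₜ m')) fun zQ m'Q =>
          (zQ * z'R) ⊗ₜ (a1R * (c * (m * m'Q))) := by
  simp only [untwist_bullet hb h, sw_comm (lamr a') (ρl _), sw_comm (lamr a') (ρr a)]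
  refine sw_congr fun a0 a1 => sw_congr fun m z => ?_
  have e := h.sw_ρr_lamr (fun x p => sw (ρl x) fun m' z' => sw (R (a1 ⊗ₜ z')) fun z'R a1R =>
    sw (Q (z ⊗ₜ m')) fun zQ m'Q => (zQ * z'R) ⊗ₜ[k] (a1R * (p * (c * (m * m'Q)))))
    linearity a'
  simpa only [mul_assoc, one_mul] using e

/-- The summand is the shape produced by a product of R̃ and Q̃ values: both λ's disappear, λl
against ρl by `ρl_laml`. -/
theorem laml_lamr_untwist_bullet (hb : BulletAxioms R Q μl μr ρr ρl)
    (h : TwistAxioms R Q μl μr ρr ρl lamr laml) (a a' : A) (c : B) :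
    (sw (laml a) fun n w => sw (lamr a') fun l0 l1 =>
        untwist ρr ρl (bullet μl μr ρr ρl w l0 ⊗ₜ (l1 * (c * n)))) =
      sw (ρr a) fun a0 a1 => sw (ρl a') fun m' z' => sw (R (a1 ⊗ₜ z')) fun z'R a1R =>
        sw (Q (a0 ⊗ₜ m')) fun a0Q m'Q => (a0Q * z'R) ⊗ₜ (a1R * (c * m'Q)) := by
  simp (disch := exact linearity) only [lamr_untwist_bullet hb h, hb.sw_ρl_ρr]
  have e := h.sw_ρl_laml (fun p x => sw (ρr x) fun a0 a1 => sw (ρl a') fun m' z' =>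
    sw (R (a1 ⊗ₜ z')) fun z'R a1R =>
        sw (Q (a0 ⊗ₜ m')) fun a0Q m'Q => (a0Q * z'R) ⊗ₜ[k] (a1R * (c * (p * m'Q))))
    linearity a
  simpa only [mul_assoc, one_mul] using e

/-- Both sides reduce to ρr, ρl, `R`, `Q`, λl, λr applied in this order: the left by `R_lamr_ρl_Q`
and `laml_lamr`, the right by `Q_laml_ρr_R` and `ρl_R`. -/
theorem tilde_comm_A (hb : BulletAxioms R Q μl μr ρr ρl)
    (h : TwistAxioms R Q μl μr ρr ρl lamr laml) (a : A) (b b' : B) :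
    (sw (tildeR R ρr lamr (b ⊗ₜ a)) fun aR bR => sw (tildeQ Q ρl laml (aR ⊗ₜ b')) fun aRQ b'Q =>
      bR ⊗ₜ[k] aRQ ⊗ₜ[k] b'Q) =
    sw (tildeQ Q ρl laml (a ⊗ₜ b')) fun aQ b'Q => sw (tildeR R ρr lamr (b ⊗ₜ aQ)) fun aQR bR =>
      bR ⊗ₜ[k] aQR ⊗ₜ[k] b'Q := by
  simp (disch := exact linearity) only [sw_tildeR, sw_tildeQ, h.sw_R_lamr_ρl_Q,
    h.sw_laml_lamr]
  have e := h.sw_Q_laml_ρr_R (fun x y m n bR b'Q => sw (lamr x) fun l0 l1 =>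
    (l1 * bR * y) ⊗ₜ[k] l0 ⊗ₜ[k] (m * b'Q * n)) linearity a b b'
  simp (disch := exact linearity) only [e, hb.sw_ρl_R]

theorem tilde_comm_B (hRQ : IsLRTwisting (LinearMap.mul k A) 1 (LinearMap.mul k B) 1 R Q)
    (h : TwistAxioms R Q μl μr ρr ρl lamr laml) (a a' : A) (b : B) :
    (sw (tildeR R ρr lamr (b ⊗ₜ a)) fun aR bR => sw (tildeQ Q ρl laml (a' ⊗ₜ bR)) fun a'Q bRQ =>
      aR ⊗ₜ[k] bRQ ⊗ₜ[k] a'Q) =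
    sw (tildeQ Q ρl laml (a' ⊗ₜ b)) fun a'Q bQ => sw (tildeR R ρr lamr (bQ ⊗ₜ a)) fun aR bQR =>
      aR ⊗ₜ[k] bQR ⊗ₜ[k] a'Q := by
  simp (disch := exact linearity) only [sw_tildeR, sw_tildeQ, hRQ.sw_R_mul, hRQ.sw_Q_mul]
  -- On the left, `Q` acts on a product of three factors; `R_lamr_Q` trades its action on the λr
  -- factor for an `R`. Symmetrically, `Q_laml_R` trades the `R` acting on the λl factor on the
  -- right for a `Q`.
  have e₁ := h.sw_R_lamr_Q (fun l0 p z a1 br => sw (Q (z ⊗ₜ br)) fun z₂ brQ =>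
    sw (Q (z₂ ⊗ₜ a1)) fun z₃ a1Q => sw (laml z₃) fun n w =>
      l0 ⊗ₜ[k] (p * brQ * a1Q * n) ⊗ₜ[k] w)
    linearity a a' b
  have e₂ := h.sw_Q_laml_R (fun p w m' a0R bQ => sw (R (bQ ⊗ₜ a0R)) fun r₂ bQR =>
    sw (R (m' ⊗ₜ r₂)) fun r₃ m'R => sw (lamr r₃) fun l0 l1 =>
      l0 ⊗ₜ[k] (l1 * m'R * bQR * p) ⊗ₜ[k] w)
    linearity a a' b
  simp only [mul_assoc] at e₁ e₂ ⊢
  simp only [sw_comm (lamr _) (ρl a'), sw_comm (R _) (ρl a'), e₁]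
  simp only [sw_comm _ (ρr a), e₂]
  refine sw_congr fun a0 a1 => sw_congr fun m z => ?_
  simp only [sw_comm (laml _) (R _), sw_comm (Q (_ ⊗ₜ a1)) (R _), sw_comm (lamr _) (Q _),
    sw_comm (lamr _) (laml _), sw_comm (R (m ⊗ₜ _)) (Q (z ⊗ₜ _))]
  -- Only the order of `R` and `Q` acting on `b` still differs.
  exact hRQ.sw_comm_B _ linearity a0 z b

theorem untwist_lrMul_tmul (hb : BulletAxioms R Q μl μr ρr ρl)
    (hRQ : IsLRTwisting (LinearMap.mul k A) 1 (LinearMap.mul k B) 1 R Q)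
    (h : TwistAxioms R Q μl μr ρr ρl lamr laml) (a a' : A) (b b' : B) :
    untwist ρr ρl (lrMul (bullet μl μr ρr ρl) (LinearMap.mul k B) (tildeR R ρr lamr)
        (tildeQ Q ρl laml) (a ⊗ₜ b) (a' ⊗ₜ b')) =
      lrMul (LinearMap.mul k A) (LinearMap.mul k B) R Q (untwist ρr ρl (a ⊗ₜ b))
        (untwist ρr ρl (a' ⊗ₜ b')) := by
  -- Normal form of the left side, free of λ: here `a'1 * m` occurs in the middle of the `B` factor.
  have hl : untwist ρr ρl (lrMul (bullet μl μr ρr ρl) (LinearMap.mul k B) (tildeR R ρr lamr)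
        (tildeQ Q ρl laml) (a ⊗ₜ b) (a' ⊗ₜ b')) =
      sw (ρr a) fun a0 a1 => sw (ρl a0) fun m z => sw (ρr a') fun a'0 a'1 =>
        sw (ρl a'0) fun m' z' => sw (Q (z ⊗ₜ b')) fun zQ b'Q => sw (Q (zQ ⊗ₜ m')) fun zq m'q =>
          sw (R (b ⊗ₜ z')) fun z'R bR => sw (R (a1 ⊗ₜ z'R)) fun z'r a1r =>
            (zq * z'r) ⊗ₜ (a1r * (bR * ((a'1 * m) * (b'Q * m'q)))) := by
    simp (disch := exact linearity) only [lrMul_mul_tmul, sw_tildeR, sw_tildeQ, map_sw]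
    simp only [sw_comm (laml _) (ρr _), sw_comm (laml _) (R _)]
    have e (w v : A) (x y m z : B) := h.laml_lamr_untwist_bullet hb w v (x * y * (m * z))
    simp only [mul_assoc] at e ⊢
    simp only [e]
    simp only [sw_comm (R _) (ρr _), sw_comm (ρr a') (ρr _)]
    -- The coactions are moved inside `Q` and `R`, so that they act on `a` and `a'` themselves.
    simp (disch := exact linearity) only [hb.sw_ρr_Q, hb.sw_ρl_R, ← hb.sw_ρl_ρr]
    refine sw_congr fun a0 a1 => sw_congr fun m z => ?_
    simp only [sw_comm (Q (z ⊗ₜ b'))]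
    refine sw_congr fun a'0 a'1 => sw_congr fun m' z' => ?_
    simp only [sw_comm (R _) (Q _)]
  -- Normal form of the right side: the same expression, except that `m` has passed `z'` through `R`
  -- and `a'1` has passed `z` through `Q`. This is the situation of `exchange`.
  have hr : lrMul (LinearMap.mul k A) (LinearMap.mul k B) R Q (untwist ρr ρl (a ⊗ₜ b))
        (untwist ρr ρl (a' ⊗ₜ b')) =
      sw (ρr a) fun a0 a1 => sw (ρl a0) fun m z => sw (ρr a') fun a'0 a'1 =>
        sw (ρl a'0) fun m' z' => sw (R (m ⊗ₜ z')) fun z'R mR => sw (Q (z ⊗ₜ a'1)) fun zQ a'1Q =>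
        sw (Q (zQ ⊗ₜ b')) fun zQ b'Q => sw (Q (zQ ⊗ₜ m')) fun zq m'q =>
          sw (R (b ⊗ₜ z'R)) fun z'R bR => sw (R (a1 ⊗ₜ z'R)) fun z'r a1r =>
            (zq * z'r) ⊗ₜ (a1r * (bR * ((mR * a'1Q) * (b'Q * m'q)))) := by
    simp only [untwist_tmul, lrMul_mul_mul_tmul, map_sw, sw_apply]
    simp only [sw_comm _ (ρr a)]
    refine sw_congr fun a0 a1 => ?_
    simp only [sw_comm _ (ρl a0)]
    refine sw_congr fun m z => sw_congr fun a'0 a'1 => sw_congr fun m' z' => ?_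
    simp (disch := exact linearity) only [hRQ.sw_R_mul, hRQ.sw_Q_mul]
    simp only [mul_assoc]
    simp only [sw_comm _ (R (m ⊗ₜ z'))]
  rw [hl, hr]
  exact (h.sw_exchange (fun u s t m' a1 => sw (Q (s ⊗ₜ b')) fun zQ b'Q =>
    sw (Q (zQ ⊗ₜ m')) fun zq m'q => sw (R (b ⊗ₜ t)) fun z'R bR =>
      sw (R (a1 ⊗ₜ z'R)) fun z'r a1r => (zq * z'r) ⊗ₜ[k] (a1r * (bR * (u * (b'Q * m'q)))))
    linearity a a').symm

end TwistAxioms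

end Twist

/-! ### Twisting axioms recovered from associativity -/

section OfAssoc

variable {k A B : Type*} [Field k] [AddCommMonoid A] [Module k A] [AddCommMonoid B] [Module k B]
  {mA : A →ₗ[k] A →ₗ[k] A} {eA : A} {mB : B →ₗ[k] B →ₗ[k] B} {eB : B}
  {R : B ⊗[k] A →ₗ[k] A ⊗[k] B} {Q : A ⊗[k] B →ₗ[k] A ⊗[k] B}

/-- Read from right to left, it presents a tensor as a Sweedler sum, into which linear maps can be
pushed. -/
theorem sw_tmul_self (t : A ⊗[k] B) : (sw t fun x y => x ⊗ₜ[k] y) = t :=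
  (sw_eq_lift (TensorProduct.mk k A B) t).trans (by rw [TensorProduct.lift_mk, LinearMap.id_apply])

/-- If the multiplication of an L-R-twisted tensor product is associative, then the
multiplicativity conditions on `R` and `Q` follow from the remaining ones. -/
theorem IsLRTwisting.of_assoc (hone : ∀ a, mA eA a = a) (hone' : ∀ a, mA a eA = a)
    (hB : IsAlgebraStructure mB eB)
    (R_one_left : ∀ a, R (eB ⊗ₜ a) = a ⊗ₜ eB) (R_one_right : ∀ b, R (b ⊗ₜ eA) = eA ⊗ₜ b)
    (Q_one_right : ∀ a, Q (a ⊗ₜ eB) = a ⊗ₜ eB) (Q_one_left : ∀ b, Q (eA ⊗ₜ b) = eA ⊗ₜ b)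
    (comm_A : ∀ a b b',
      (sw (R (b ⊗ₜ a)) fun aR bR => sw (Q (aR ⊗ₜ b')) fun aRQ b'Q =>
        bR ⊗ₜ[k] aRQ ⊗ₜ[k] b'Q) =
      sw (Q (a ⊗ₜ b')) fun aQ b'Q => sw (R (b ⊗ₜ aQ)) fun aQR bR => bR ⊗ₜ[k] aQR ⊗ₜ[k] b'Q)
    (comm_B : ∀ a a' b,
      (sw (R (b ⊗ₜ a)) fun aR bR => sw (Q (a' ⊗ₜ bR)) fun a'Q bRQ =>
        aR ⊗ₜ[k] bRQ ⊗ₜ[k] a'Q) =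
      sw (Q (a' ⊗ₜ b)) fun a'Q bQ => sw (R (bQ ⊗ₜ a)) fun aR bQR => aR ⊗ₜ[k] bQR ⊗ₜ[k] a'Q)
    (assoc : ∀ x y z, lrMul mA mB R Q (lrMul mA mB R Q x y) z =
      lrMul mA mB R Q x (lrMul mA mB R Q y z)) :
    IsLRTwisting mA eA mB eB R Q := by
  -- When one of the four entries is a unit, the product involves only one of `R` and `Q`; two unit
  -- entries in the right places give `R`, `Q`, `mA` or `mB` itself.
  have one_right (a : A) (b : B) (a' : A) : lrMul mA mB R Q (a ⊗ₜ b) (a' ⊗ₜ eB) =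
      sw (R (b ⊗ₜ a')) fun a'R bR => mA a a'R ⊗ₜ bR := by
    simp (disch := exact linearity) only [lrMul_tmul, Q_one_right, sw_tmul, hB.mul_one]
  have one_left (b : B) (a' : A) (b' : B) : lrMul mA mB R Q (eA ⊗ₜ b) (a' ⊗ₜ b') =
      sw (R (b ⊗ₜ a')) fun a'R bR => a'R ⊗ₜ mB bR b' := by
    simp (disch := exact linearity) only [lrMul_tmul, Q_one_left, sw_tmul, hone]
  have left_one (a a' : A) (b' : B) : lrMul mA mB R Q (a ⊗ₜ eB) (a' ⊗ₜ b') =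
      sw (Q (a ⊗ₜ b')) fun aQ b'Q => mA aQ a' ⊗ₜ b'Q := by
    simp (disch := exact linearity) only [lrMul_tmul, R_one_left, sw_tmul, hB.one_mul]
  have right_one (a : A) (b b' : B) : lrMul mA mB R Q (a ⊗ₜ b) (eA ⊗ₜ b') =
      sw (Q (a ⊗ₜ b')) fun aQ b'Q => aQ ⊗ₜ mB b b'Q := by
    simp (disch := exact linearity) only [lrMul_tmul, R_one_right, sw_tmul, hone']
  have eq_R (b : B) (a : A) : lrMul mA mB R Q (eA ⊗ₜ b) (a ⊗ₜ eB) = R (b ⊗ₜ a) := by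
    simp only [one_right, hone, sw_tmul_self]
  have eq_Q (a : A) (b : B) : lrMul mA mB R Q (a ⊗ₜ eB) (eA ⊗ₜ b) = Q (a ⊗ₜ b) := by
    simp only [right_one, hB.one_mul, sw_tmul_self]
  have eq_A (a a' : A) : lrMul mA mB R Q (a ⊗ₜ eB) (a' ⊗ₜ eB) = mA a a' ⊗ₜ eB := by
    rw [left_one, Q_one_right, sw_tmul _ (fun y => lin_tmul (lin_app₂ mA lin_id a') y)
      (fun x => lin_tmul' _ lin_id)]
  have eq_B (b b' : B) : lrMul mA mB R Q (eA ⊗ₜ b) (eA ⊗ₜ b') = eA ⊗ₜ mB b b' := by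
    rw [right_one, Q_one_left, sw_tmul _ (fun y => lin_tmul lin_id _)
      (fun x => lin_tmul' _ (lin_app (mB b) lin_id))]
  refine ⟨R_one_left, R_one_right, ?_, ?_, Q_one_right, Q_one_left, ?_, ?_, comm_A, comm_B⟩
  -- Each axiom is associativity for one triple; here (1 ⊗ b), (a ⊗ 1), (a' ⊗ 1). Associativity of
  -- `mA` is not presupposed, which matters because that of • is still open.
  · intro a a' b
    have e := assoc (eA ⊗ₜ b) (a ⊗ₜ eB) (a' ⊗ₜ eB)
    rw [eq_A, eq_R, eq_R, ← sw_tmul_self (R (b ⊗ₜ a))] at e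
    simpa only [map_sw, sw_apply, one_right] using e.symm
  · intro a b b'
    have e := assoc (eA ⊗ₜ b) (eA ⊗ₜ b') (a ⊗ₜ eB)
    rw [eq_B, eq_R, eq_R, ← sw_tmul_self (R (b' ⊗ₜ a))] at e
    simpa only [map_sw, sw_apply, one_left] using e
  · intro a a' b
    have e := assoc (a ⊗ₜ eB) (a' ⊗ₜ eB) (eA ⊗ₜ b)
    rw [eq_A, eq_Q, eq_Q, ← sw_tmul_self (Q (a' ⊗ₜ b))] at e
    simpa only [map_sw, sw_apply, left_one] using e
  · intro a b b'
    have e := assoc (a ⊗ₜ eB) (eA ⊗ₜ b) (eA ⊗ₜ b')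
    rw [eq_B, eq_Q, eq_Q, ← sw_tmul_self (Q (a ⊗ₜ b))] at e
    simpa only [map_sw, sw_apply, right_one] using e.symm

end OfAssoc

/-! ### Transport of associativity and proof of the theorem -/

section Twist

variable {k A B : Type*} [Field k] [Ring A] [Algebra k A] [Ring B] [Algebra k B]
  {R : B ⊗[k] A →ₗ[k] A ⊗[k] B} {Q : A ⊗[k] B →ₗ[k] A ⊗[k] B}
  {μl : B ⊗[k] A →ₗ[k] A} {μr : A ⊗[k] B →ₗ[k] A}
  {ρr : A →ₗ[k] A ⊗[k] B} {ρl : A →ₗ[k] B ⊗[k] A}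
  {lamr : A →ₗ[k] A ⊗[k] B} {laml : A →ₗ[k] B ⊗[k] A}

theorem isAlgebraStructure_mul : IsAlgebraStructure (LinearMap.mul k A) 1 where
  mul_assoc := mul_assoc
  one_mul := one_mul
  mul_one := mul_one

theorem BulletAxioms.tmul_one_injective (hb : BulletAxioms R Q μl μr ρr ρl) :
    Function.Injective fun a : A => a ⊗ₜ[k] (1 : B) := by
  rcases subsingleton_or_nontrivial B with hB | hB
  -- If `B` is zero, then so is `A`, since a = a₍₀₎ (a₍₁₎ · 1) with a₍₁₎ = 0.
  · have hzero (a : A) : a = 0 := by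
      have h := hb.ρr_act_one a
      have e (x : A) (b : B) : x * μl (b ⊗ₜ 1) = 0 := by
        rw [Subsingleton.elim b 0, TensorProduct.zero_tmul, map_zero, mul_zero]
      simpa only [sw, e, Finset.sum_const_zero] using h.symm
    intro a a' _
    rw [hzero a, hzero a']
  · exact Algebra.TensorProduct.includeLeft_injective (S := k)
      (FaithfulSMul.algebraMap_injective k B)

namespace TwistAxioms

theorem tildeR_one_left (h : TwistAxioms R Q μl μr ρr ρl lamr laml)
    (hRQ : IsLRTwisting (LinearMap.mul k A) 1 (LinearMap.mul k B) 1 R Q) (a : A) :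
    tildeR R ρr lamr (1 ⊗ₜ a) = a ⊗ₜ 1 := by
  rw [← sw_tmul_self (tildeR R ρr lamr _)]
  simp (disch := exact linearity) only [sw_tildeR, hRQ.R_one_left, sw_tmul, mul_one, h.lamr_ρr]

theorem tildeR_one_right (hb : BulletAxioms R Q μl μr ρr ρl)
    (h : TwistAxioms R Q μl μr ρr ρl lamr laml)
    (hRQ : IsLRTwisting (LinearMap.mul k A) 1 (LinearMap.mul k B) 1 R Q) (b : B) :
    tildeR R ρr lamr (b ⊗ₜ 1) = 1 ⊗ₜ b := by
  rw [← sw_tmul_self (tildeR R ρr lamr _)]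
  simp (disch := exact linearity) only [sw_tildeR, hb.ρr_one, hRQ.R_one_right, h.lamr_one,
    sw_tmul, mul_one, one_mul]

theorem tildeQ_one_right (h : TwistAxioms R Q μl μr ρr ρl lamr laml)
    (hRQ : IsLRTwisting (LinearMap.mul k A) 1 (LinearMap.mul k B) 1 R Q) (a : A) :
    tildeQ Q ρl laml (a ⊗ₜ 1) = a ⊗ₜ 1 := by
  rw [← sw_tmul_self (tildeQ Q ρl laml _)]
  simp (disch := exact linearity) only [sw_tildeQ, hRQ.Q_one_right, sw_tmul, mul_one]
  exact h.sw_laml_ρl (fun x y => y ⊗ₜ[k] x) linearity a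

theorem tildeQ_one_left (hb : BulletAxioms R Q μl μr ρr ρl)
    (h : TwistAxioms R Q μl μr ρr ρl lamr laml)
    (hRQ : IsLRTwisting (LinearMap.mul k A) 1 (LinearMap.mul k B) 1 R Q) (b : B) :
    tildeQ Q ρl laml (1 ⊗ₜ b) = 1 ⊗ₜ b := by
  rw [← sw_tmul_self (tildeQ Q ρl laml _)]
  simp (disch := exact linearity) only [sw_tildeQ, hb.ρl_one, hRQ.Q_one_left, h.laml_one,
    sw_tmul, mul_one, one_mul]

theorem untwist_lrMul (hb : BulletAxioms R Q μl μr ρr ρl)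
    (hRQ : IsLRTwisting (LinearMap.mul k A) 1 (LinearMap.mul k B) 1 R Q)
    (h : TwistAxioms R Q μl μr ρr ρl lamr laml) (x y : A ⊗[k] B) :
    untwist ρr ρl (lrMul (bullet μl μr ρr ρl) (LinearMap.mul k B) (tildeR R ρr lamr)
        (tildeQ Q ρl laml) x y) =
      lrMul (LinearMap.mul k A) (LinearMap.mul k B) R Q (untwist ρr ρl x) (untwist ρr ρl y) := by
  induction x with
  | zero => simp
  | add x x' hx hx' => simp only [map_add, LinearMap.add_apply, hx, hx']
  | tmul a b =>
  induction y with
  | zero => simp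
  | add x x' hx hx' => simp only [map_add, hx, hx']
  | tmul a' b' => exact h.untwist_lrMul_tmul hb hRQ a a' b b'

/-- The isomorphism `a ⊗ b ↦ a_{(0)_{<0>}} ⊗ a_{(1)} b a_{(0)_{<-1>}}`. -/
def untwistEquiv (hb : BulletAxioms R Q μl μr ρr ρl)
    (h : TwistAxioms R Q μl μr ρr ρl lamr laml) : A ⊗[k] B ≃ₗ[k] A ⊗[k] B :=
  LinearEquiv.ofLinearMap (untwist ρr ρl) (untwist lamr laml) h.untwist_untwist_lam
    (h.untwist_lam_untwist hb)

theorem tilde_assoc (hb : BulletAxioms R Q μl μr ρr ρl)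
    (hRQ : IsLRTwisting (LinearMap.mul k A) 1 (LinearMap.mul k B) 1 R Q)
    (h : TwistAxioms R Q μl μr ρr ρl lamr laml) (x y z : A ⊗[k] B) :
    lrMul (bullet μl μr ρr ρl) (LinearMap.mul k B) (tildeR R ρr lamr) (tildeQ Q ρl laml)
      (lrMul (bullet μl μr ρr ρl) (LinearMap.mul k B) (tildeR R ρr lamr) (tildeQ Q ρl laml) x y) z =
    lrMul (bullet μl μr ρr ρl) (LinearMap.mul k B) (tildeR R ρr lamr) (tildeQ Q ρl laml) x
      (lrMul (bullet μl μr ρr ρl) (LinearMap.mul k B) (tildeR R ρr lamr) (tildeQ Q ρl laml) y z) := by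
  apply (h.untwistEquiv hb).injective
  change untwist ρr ρl _ = untwist ρr ρl _
  simp only [h.untwist_lrMul hb hRQ, hRQ.lrMul_assoc isAlgebraStructure_mul isAlgebraStructure_mul]

theorem tilde_isLRTwisting (hb : BulletAxioms R Q μl μr ρr ρl)
    (hRQ : IsLRTwisting (LinearMap.mul k A) 1 (LinearMap.mul k B) 1 R Q)
    (h : TwistAxioms R Q μl μr ρr ρl lamr laml) :
    IsLRTwisting (bullet μl μr ρr ρl) 1 (LinearMap.mul k B) 1
      (tildeR R ρr lamr) (tildeQ Q ρl laml) :=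
  .of_assoc hb.one_bullet hb.bullet_one isAlgebraStructure_mul (h.tildeR_one_left hRQ)
    (h.tildeR_one_right hb hRQ) (h.tildeQ_one_right hRQ) (h.tildeQ_one_left hb hRQ)
    (h.tilde_comm_A hb) (h.tilde_comm_B hRQ) (h.tilde_assoc hb hRQ)

theorem isAlgebraStructure_bullet (hb : BulletAxioms R Q μl μr ρr ρl)
    (hRQ : IsLRTwisting (LinearMap.mul k A) 1 (LinearMap.mul k B) 1 R Q)
    (h : TwistAxioms R Q μl μr ρr ρl lamr laml) :
    IsAlgebraStructure (bullet μl μr ρr ρl) 1 where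
  mul_assoc a a' a'' := by
    apply hb.tmul_one_injective
    -- By the unit conditions on R̃ and Q̃, (a ⊗ 1)(a' ⊗ 1) = (a • a') ⊗ 1.
    have e := h.tilde_assoc hb hRQ (a ⊗ₜ 1) (a' ⊗ₜ 1) (a'' ⊗ₜ 1)
    simpa (disch := exact linearity) only [lrMul_mul_tmul, h.tildeR_one_left hRQ,
      h.tildeQ_one_right hRQ, sw_tmul, mul_one] using e
  one_mul := hb.one_bullet
  mul_one := hb.bullet_one

end TwistAxioms

end Twist

end

end LRTwist

theorem theorem4 {k A B : Type*} [Field k] [Ring A] [Algebra k A] [Ring B] [Algebra k B]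
    (R : B ⊗[k] A →ₗ[k] A ⊗[k] B) (Q : A ⊗[k] B →ₗ[k] A ⊗[k] B)
    (μl : B ⊗[k] A →ₗ[k] A) (μr : A ⊗[k] B →ₗ[k] A)
    (ρr : A →ₗ[k] A ⊗[k] B) (ρl : A →ₗ[k] B ⊗[k] A)
    (lamr : A →ₗ[k] A ⊗[k] B) (laml : A →ₗ[k] B ⊗[k] A)
    (hbullet : BulletAxioms R Q μl μr ρr ρl)
    (hRQ : IsLRTwisting (LinearMap.mul k A) 1 (LinearMap.mul k B) 1 R Q)
    (htwist : TwistAxioms R Q μl μr ρr ρl lamr laml) :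
    IsAlgebraStructure (bullet μl μr ρr ρl) 1 ∧
    IsLRTwisting (bullet μl μr ρr ρl) 1 (LinearMap.mul k B) 1
      (tildeR R ρr lamr) (tildeQ Q ρl laml) ∧
    IsAlgebraStructure (lrMul (bullet μl μr ρr ρl) (LinearMap.mul k B)
      (tildeR R ρr lamr) (tildeQ Q ρl laml)) (1 ⊗ₜ[k] 1) ∧
    IsAlgebraStructure (lrMul (LinearMap.mul k A) (LinearMap.mul k B) R Q) (1 ⊗ₜ[k] 1) ∧
    ∃ φ : A ⊗[k] B ≃ₗ[k] A ⊗[k] B,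
      (∀ a b, φ (a ⊗ₜ b) =
        sw (ρr a) fun a0 a1 => sw (ρl a0) fun m z => z ⊗ₜ (a1 * b * m)) ∧
      φ (1 ⊗ₜ 1) = 1 ⊗ₜ 1 ∧
      ∀ x y,
        φ (lrMul (bullet μl μr ρr ρl) (LinearMap.mul k B)
            (tildeR R ρr lamr) (tildeQ Q ρl laml) x y) =
          lrMul (LinearMap.mul k A) (LinearMap.mul k B) R Q (φ x) (φ y) := by
  have hA := htwist.isAlgebraStructure_bullet hbullet hRQ
  have hT := htwist.tilde_isLRTwisting hbullet hRQ
  refine ⟨hA, hT, hT.isAlgebraStructure hA isAlgebraStructure_mul,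
    hRQ.isAlgebraStructure isAlgebraStructure_mul isAlgebraStructure_mul,
    htwist.untwistEquiv hbullet, untwist_tmul, ?_, htwist.untwist_lrMul hbullet hRQ⟩
  change untwist ρr ρl _ = _
  simp (disch := exact linearity) only [untwist_tmul, hbullet.ρr_one, hbullet.ρl_one, sw_tmul,
    mul_one]
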